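/- \textbf{Problem.} Let $\mathcal X\subset\mathbb R^n$ be convex and compact, $\mathcal K\subset\mathbb R^m$ a proper cone (closed, convex, pointed, with nonempty interior), $A\in\mathbb R^{p\times n}$ with $\operatorname{rank}A=p<n$, $b\in\mathbb R^p$, and let $\mu\ge 0$. Let $f:\mathbb R^n\to\mathbb R$ be convex on $\mathcal X$ with modulus $\mu$ (i.e. $f-\frac\mu2\|\cdot\|^2$ is convex on $\mathcal X$), let $g:\mathbb R^n\to\mathbb R^m$ be $\mathcal K$-convex on $\mathcal X$, and suppose that $f,g$ are continuously differentiable on an open set containing $\mathcal X$, with $\nabla f$ and the Jacobian $\nabla g$ Lipschitz on $\mathcal X$. Consider $$f^\star=\min_{x\in\mathcal X}\{f(x):\ Ax=b,\ g(x)\in-\mathcal K\},\qquad \Phi(x,y)=f(x)+\langle v,Ax-b\rangle+\langle\lambda,g(x)\rangle,$$ where $y=(v,\lambda)\in\mathcal Y=\mathbb R^p\times\mathcal K^*$, $\mathcal K^*$ is the dual cone, and all norms are Euclidean (spectral for matrices). Assume that $\Phi$ has a saddle point on $\mathcal X\times\mathcal Y$ (min in $x$, max in $y$). Let $\varphi_p:\mathbb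 R^n\to\mathbb R$ and $\varphi_d:\mathbb R^p\times\mathbb R^m\to\mathbb R$ be $1$-strongly convex, differentiable on open sets containing $\mathcal X$ and $\mathcal Y$ respectively, with gradients that are Lipschitz on $\mathcal X$ and $\mathcal Y$; let $\mathbf D_p,\mathbf D_d$ be their Bregman distances, $\mathbf D(u,w)=\varphi(u)-\varphi(w)-\langle\nabla\varphi(w),u-w\rangle$. If $\mu>0$, take $\varphi_p=\frac12\|\cdot\|^2$. \textbf{Algorithms.} The parameters are $\eta\in(0,1)$, $\bar\tau>0$, $\gamma_0>0$, $c_{\rm nm}\in\{0,1\}$ and $c_\alpha,c_\beta,\delta$, where $c_\alpha,c_\beta>0$, $\delta\ge0$, $c_\alpha+c_\beta+\delta<1$ for APDB-xy, and $c_\alpha>0$, $c_\beta=0$, $\delta\in[0,1)$, $c_\alpha+\delta\le1$ for APDB-yx. For APDB-xy put $\hat{\mathcal Y}=\mathcal Y$. For APDB-yx assume moreover that some dual optimal solution $y^\star$ (a maximizer over $\mathcal Y$ of $y\mapsto\inf_{x\in\mathcal X}\Phi(x,y)$) satisfies $\|y^\star\|\le\bar B$ for some $\bar B>0$, fix $B>\bar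 B$, and put $\hat{\mathcal Y}=\{y\in\mathcal Y:\|y\|\le B\}$. Start from any $(x^0,y^0)\in\mathcal X\times\hat{\mathcal Y}$, with $(x^{-1},y^{-1})=(x^0,y^0)$, $\tau_{-1}=\bar\tau$, $\sigma_{-1}=\gamma_0\bar\tau$, and let $\tau_0=\bar\tau$ be the initial trial value. Iteration $k=0,1,\dots$: for the current trial value $\tau_k$ put $\sigma_k=\gamma_k\tau_k$, $\theta_k=\sigma_{k-1}/\sigma_k$ and compute a candidate $(x^{k+1},y^{k+1})$ as follows. APDB-xy: $\alpha_{k+1}=c_\alpha/\tau_k$, $\beta_{k+1}=\gamma_0c_\beta/\sigma_k$, $s^k=(1+\theta_k)\nabla_x\Phi(x^k,y^k)-\theta_k\nabla_x\Phi(x^{k-1},y^{k-1})$, $$x^{k+1}=\arg\min_{x\in\mathcal X}\{\langle s^k,x\rangle+\tfrac1{\tau_k}\mathbf D_p(x,x^k)\},\quad y^{k+1}=\arg\min_{y\in\hat{\mathcal Y}}\{-\langle\nabla_y\Phi(x^{k+1},y^k),y\rangle+\tfrac1{\sigma_k}\mathbf D_d(y,y^k)\},$$ $$E_k(x,y)=\tfrac{1}{2\alpha_{k+1}}\|\nabla_x\Phi(x,y)-\nabla_x\Phi(x,y^k)\|^2-\tfrac1{\sigma_k}\mathbf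 D_d(y,y^k)+\tfrac1{2\beta_{k+1}}\|\nabla_x\Phi(x,y^k)-\nabla_x\Phi(x^k,y^k)\|^2-\bigl(\tfrac1{\tau_k}-\theta_k(\alpha_k+\beta_k)\bigr)\mathbf D_p(x,x^k).$$ APDB-yx: $\alpha_{k+1}=c_\alpha/\sigma_k$, $\beta_{k+1}=0$, $s^k=(1+\theta_k)\nabla_y\Phi(x^k,y^k)-\theta_k\nabla_y\Phi(x^{k-1},y^{k-1})$, $$y^{k+1}=\arg\min_{y\in\hat{\mathcal Y}}\{-\langle s^k,y\rangle+\tfrac1{\sigma_k}\mathbf D_d(y,y^k)\},\quad x^{k+1}=\arg\min_{x\in\mathcal X}\{\langle\nabla_x\Phi(x^k,y^{k+1}),x\rangle+\tfrac1{\tau_k}\mathbf D_p(x,x^k)\},$$ $$E_k(x,y)=\Phi(x,y)-\Phi(x^k,y)-\langle\nabla_x\Phi(x^k,y),x-x^k\rangle-\tfrac1{\tau_k}\mathbf D_p(x,x^k)+\tfrac1{2\alpha_{k+1}}\|\nabla_y\Phi(x,y)-\nabla_y\Phi(x^k,y)\|^2-\bigl(\tfrac1{\sigma_k}-\theta_k\alpha_k\bigr)\mathbf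 D_d(y,y^k).$$ Here $\alpha_0,\beta_0$ are given by the same formulas at $k=-1$. The candidate is accepted if $E_k(x^{k+1},y^{k+1})\le-\frac\delta{\tau_k}\mathbf D_p(x^{k+1},x^k)-\frac\delta{\sigma_k}\mathbf D_d(y^{k+1},y^k)$; otherwise $\tau_k$ is replaced by $\eta\tau_k$ and the candidate is recomputed. After acceptance, $\gamma_{k+1}=\gamma_k(1+\mu\tau_k)$ and the next initial trial value is $\tau_{k+1}=\tau_k\sqrt{\frac{\gamma_k}{\gamma_{k+1}}\bigl(1+c_{\rm nm}\frac{\tau_k}{\tau_{k-1}}\bigr)}$. Put $t_k=\sigma_k/\sigma_0$, $T_K=\sum_{k=0}^{K-1}t_k$ and $\bar x^K=\frac1{T_K}\sum_{k=0}^{K-1}t_kx^{k+1}$. \textbf{Lemma.} For each of APDB-xy and APDB-yx, the algorithm is well defined (all its argmins exist and every backtracking loop terminates), and there are constants $C,a,C'>0$ independent of $K$ such that for all $K\ge1$ $$\max\Bigl\{\operatorname{dist}\Bigl(\begin{bmatrix}A\bar x^K-b\\-g(\bar x^K)\end{bmatrix},\{0\}\times\mathcal K\Bigr),\ |f(\bar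 x^K)-f^\star|\Bigr\}\le\frac{C}{T_K};$$ moreover $T_K\ge aK$ if $\mu=0$, while $T_K\ge aK^2$ if $\mu>0$; and if $\mu>0$, every optimal solution $x^\star$ of the conic program satisfies $\|\bar x^K-x^\star\|^2\le C'/K^2$. -/

import Mathlib

open Set
open scoped InnerProductSpace

noncomputable section

namespace APDB

/-- The primal space `ℝⁿ` (also used for `ℝᵖ` and `ℝᵐ`) with the Euclidean norm. -/
abbrev Euc (n : ℕ) : Type := EuclideanSpace ℝ (Fin n)

/-- The dual space `ℝᵖ × ℝᵐ` with the Euclidean norm `‖(v, l)‖² = ‖v‖² + ‖l‖²`. -/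
abbrev Dual (p m : ℕ) : Type := WithLp 2 (Euc p × Euc m)

/-! ### The nonlinear conic program -/

/-- The data of the conic program `min {f x : x ∈ X, A x = b, g x ∈ -K}`.
(`ProperCone` is Mathlib's name for a closed convex cone containing `0`.) -/
structure Problem (n p m : ℕ) where
  X : Set (Euc n)
  K : ProperCone ℝ (Euc m)
  A : Matrix (Fin p) (Fin n) ℝ
  b : Euc p
  f : Euc n → ℝ
  g : Euc n → Euc m

namespace Problem

variable {n p m : ℕ} (P : Problem n p m)

/-- The equality residual `A x - b`. -/
def eqRes (x : Euc n) : Euc p := P.A.toEuclideanLin x - P.b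

/-- The primal feasible set. -/
def feasible : Set (Euc n) := {x | x ∈ P.X ∧ P.eqRes x = 0 ∧ -P.g x ∈ P.K}

/-- The optimal value `f⋆`. -/
def fStar : ℝ := sInf (P.f '' P.feasible)

/-- The set of primal optimal solutions. -/
def primalOpt : Set (Euc n) := {x | x ∈ P.feasible ∧ ∀ u ∈ P.feasible, P.f x ≤ P.f u}

/-- The dual domain `Y = ℝᵖ × K^*`, where `K^*` is the dual cone of `K`. -/
def Y : Set (Dual p m) := {y | y.snd ∈ ProperCone.innerDual (P.K : Set (Euc m))}

/-- The coupling function `Φ(x, (v, l)) = f x + ⟪v, A x - b⟫ + ⟪l, g x⟫`. -/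
def Φ (x : Euc n) (y : Dual p m) : ℝ :=
  P.f x + ⟪y.fst, P.eqRes x⟫_ℝ + ⟪y.snd, P.g x⟫_ℝ

/-- The partial gradient of `Φ` in `x`. -/
def gradX (x : Euc n) (y : Dual p m) : Euc n := gradient (fun u => P.Φ u y) x

/-- The partial gradient of `Φ` in `y`. -/
def gradY (x : Euc n) (y : Dual p m) : Dual p m := gradient (fun w => P.Φ x w) y

/-- The saddle points of the Lagrangian `ι_X(x) + Φ(x,y) - ι_Y(y)`. -/
def saddle : Set (Euc n × Dual p m) :=
  {z | z.1 ∈ P.X ∧ z.2 ∈ P.Y ∧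
    (∀ y ∈ P.Y, P.Φ z.1 y ≤ P.Φ z.1 z.2) ∧ (∀ x ∈ P.X, P.Φ z.1 z.2 ≤ P.Φ x z.2)}

/-- The dual function `q(y) = inf_{x ∈ X} Φ(x, y)` for `y ∈ Y`. -/
def dualFun (y : Dual p m) : ℝ := sInf ((fun x => P.Φ x y) '' P.X)

/-- The set of dual optimal solutions. -/
def dualOpt : Set (Dual p m) := {y | y ∈ P.Y ∧ ∀ w ∈ P.Y, P.dualFun w ≤ P.dualFun y}

/-- The conic infeasibility `dist ((A x - b, -g x), {0} × K)`. -/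
def infeas (x : Euc n) : ℝ :=
  Metric.infDist (WithLp.toLp 2 (P.eqRes x, -P.g x) : Dual p m) {w | w.fst = 0 ∧ w.snd ∈ P.K}

/-- `X` is convex and compact, `K` is a proper cone (closed, convex, pointed, with nonempty
interior), and `rank A = p < n`. -/
structure SetsOK : Prop where
  convex_X : Convex ℝ P.X
  compact_X : IsCompact P.X
  pointed_K : ∀ w ∈ P.K, -w ∈ P.K → w = 0
  interior_K : (interior (P.K : Set (Euc m))).Nonempty
  rank_A : P.A.rank = p
  p_lt_n : p < n

/-- `f` is convex on `X` with modulus `μ ≥ 0`, `g` is `K`-convex on `X`, both are continuously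
differentiable on an open set containing `X`, with Lipschitz derivatives on `X` (the derivative
of `g` being measured in the operator norm). -/
structure FunctionsOK (μ : ℝ) : Prop where
  mu_nonneg : 0 ≤ μ
  convex_f : StrongConvexOn P.X μ P.f
  convex_g : ∀ x ∈ P.X, ∀ u ∈ P.X, ∀ a b : ℝ, 0 ≤ a → 0 ≤ b → a + b = 1 →
    a • P.g x + b • P.g u - P.g (a • x + b • u) ∈ P.K
  smooth : ∃ U : Set (Euc n), IsOpen U ∧ P.X ⊆ U ∧ ContDiffOn ℝ 1 P.f U ∧ ContDiffOn ℝ 1 P.g U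
  lipschitz_f : ∃ Lf : ℝ, 0 ≤ Lf ∧ ∀ x ∈ P.X, ∀ u ∈ P.X,
    ‖gradient P.f u - gradient P.f x‖ ≤ Lf * ‖u - x‖
  lipschitz_g : ∃ Lg : ℝ, 0 ≤ Lg ∧ ∀ x ∈ P.X, ∀ u ∈ P.X,
    ‖fderiv ℝ P.g u - fderiv ℝ P.g x‖ ≤ Lg * ‖u - x‖

end Problem

/-! ### Bregman distances -/

section Bregman

variable {E : Type*} [NormedAddCommGroup E] [InnerProductSpace ℝ E] [CompleteSpace E]

/-- The Bregman distance `D(u, w) = φ u - φ w - ⟪∇φ w, u - w⟫`. -/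
def bregman (φ : E → ℝ) (u w : E) : ℝ := φ u - φ w - ⟪gradient φ w, u - w⟫_ℝ

/-- `φ` is a distance generating function for the set `S`: it is `1`-strongly convex,
differentiable on an open set containing `S`, and `∇φ` is Lipschitz on `S`.
(A finite convex function on a finite-dimensional space is automatically closed.) -/
structure IsDistGen (φ : E → ℝ) (S : Set E) : Prop where
  strongConvex : StrongConvexOn univ 1 φ
  differentiable : ∃ U : Set E, IsOpen U ∧ S ⊆ U ∧ DifferentiableOn ℝ φ U
  lipschitz : ∃ L : ℝ, 0 < L ∧ ∀ u ∈ S, ∀ w ∈ S, ‖gradient φ u - gradient φ w‖ ≤ L * ‖u - w‖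

/-- `u` is a minimizer of `F` over `S`, i.e. `u ∈ argmin_S F`. -/
def IsArgmin (F : E → ℝ) (S : Set E) (u : E) : Prop := u ∈ S ∧ ∀ w ∈ S, F u ≤ F w

end Bregman

/-! ### The algorithms -/

/-- The two variants: `xy` updates `x` first; `yx B` updates `y` first and restricts the dual
variable to the ball of radius `B`. -/
inductive Variant where
  | xy : Variant
  | yx (B : ℝ) : Variant

/-- The algorithm parameters. `cnm` is the switch `c_nm ∈ {0, 1}` between the monotone and the
non-monotone step-size search. -/
structure Params where
  cα : ℝ
  cβ : ℝ
  δ : ℝ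
  η : ℝ
  τbar : ℝ
  γ₀ : ℝ
  cnm : ℝ

/-- The admissible parameters of each variant. -/
structure Params.OK (c : Params) (v : Variant) : Prop where
  cα_pos : 0 < c.cα
  δ_nonneg : 0 ≤ c.δ
  coeffs : match v with
    | .xy => 0 < c.cβ ∧ c.cα + c.cβ + c.δ < 1
    | .yx _ => c.cβ = 0 ∧ c.δ < 1 ∧ c.cα + c.δ ≤ 1
  η_pos : 0 < c.η
  η_lt_one : c.η < 1
  τbar_pos : 0 < c.τbar
  γ₀_pos : 0 < c.γ₀
  cnm_mem : c.cnm = 0 ∨ c.cnm = 1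

/-- The dual domain of each variant: `Y` for `xy` and `Y ∩ {‖y‖ ≤ B}` for `yx B`. -/
def Variant.dualDomain {n p m : ℕ} (v : Variant) (P : Problem n p m) : Set (Dual p m) :=
  match v with
  | .xy => P.Y
  | .yx B => {y | y ∈ P.Y ∧ ‖y‖ ≤ B}

/-- The additional assumption of the `yx` variant: a radius `Bbar > 0` is known such that some dual
optimal solution has norm at most `Bbar`, and `B > Bbar`. Nothing is assumed for `xy`. -/
def Variant.DualBound {n p m : ℕ} (v : Variant) (P : Problem n p m) : Prop :=
  match v with
  | .xy => True
  | .yx B => ∃ Bbar : ℝ, 0 < Bbar ∧ (∃ y ∈ P.dualOpt, ‖y‖ ≤ Bbar) ∧ Bbar < B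

/-- What is known when iteration `k` starts: `x^k`, `x^{k-1}`, `y^k`, `y^{k-1}`, `γ_k`, `σ_{k-1}`,
`α_k` and `β_k`. -/
structure Iter (n p m : ℕ) where
  x : Euc n
  xPrev : Euc n
  y : Dual p m
  yPrev : Dual p m
  γ : ℝ
  σPrev : ℝ
  α : ℝ
  β : ℝ

section Step

variable {n p m : ℕ} (P : Problem n p m) (φp : Euc n → ℝ) (φd : Dual p m → ℝ) (c : Params)

/-- `α_{k+1}` as a function of `τ_k` and `σ_k`. -/
def nextα (v : Variant) (τ σ : ℝ) : ℝ :=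
  match v with
  | .xy => c.cα / τ
  | .yx _ => c.cα / σ

/-- `β_{k+1}` as a function of `σ_k`. -/
def nextβ (v : Variant) (σ : ℝ) : ℝ :=
  match v with
  | .xy => c.γ₀ * (c.cβ / σ)
  | .yx _ => 0

/-- `(x', y')` is the candidate for `(x^{k+1}, y^{k+1})` computed with the trial step size `τ`,
`σ = γ_k τ` and `θ = σ_{k-1} / σ`. -/
def IsCandidate (v : Variant) (I : Iter n p m) (τ : ℝ) (x' : Euc n) (y' : Dual p m) : Prop :=
  let σ := I.γ * τ
  let θ := I.σPrev / σ
  match v with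
  | .xy =>
    IsArgmin (fun u => ⟪(1 + θ) • P.gradX I.x I.y - θ • P.gradX I.xPrev I.yPrev, u⟫_ℝ
      + 1 / τ * bregman φp u I.x) P.X x' ∧
    IsArgmin (fun w => -⟪P.gradY x' I.y, w⟫_ℝ + 1 / σ * bregman φd w I.y)
      (Variant.dualDomain .xy P) y'
  | .yx B =>
    IsArgmin (fun w => -⟪(1 + θ) • P.gradY I.x I.y - θ • P.gradY I.xPrev I.yPrev, w⟫_ℝ
      + 1 / σ * bregman φd w I.y) (Variant.dualDomain (.yx B) P) y' ∧
    IsArgmin (fun u => ⟪P.gradX I.x y', u⟫_ℝ + 1 / τ * bregman φp u I.x) P.X x'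

/-- The test function `E_k` at `(x', y')` for the trial step size `τ`. -/
def testFun (v : Variant) (I : Iter n p m) (τ : ℝ) (x' : Euc n) (y' : Dual p m) : ℝ :=
  let σ := I.γ * τ
  let θ := I.σPrev / σ
  let α' := nextα c v τ σ
  let β' := nextβ c v σ
  match v with
  | .xy =>
    1 / (2 * α') * ‖P.gradX x' y' - P.gradX x' I.y‖ ^ 2
      - 1 / σ * bregman φd y' I.y
      + 1 / (2 * β') * ‖P.gradX x' I.y - P.gradX I.x I.y‖ ^ 2
      - (1 / τ - θ * (I.α + I.β)) * bregman φp x' I.x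
  | .yx _ =>
    P.Φ x' y' - P.Φ I.x y' - ⟪P.gradX I.x y', x' - I.x⟫_ℝ
      - 1 / τ * bregman φp x' I.x
      + 1 / (2 * α') * ‖P.gradY x' y' - P.gradY I.x y'‖ ^ 2
      - (1 / σ - θ * I.α) * bregman φd y' I.y

/-- The acceptance test of the backtracking loop. -/
def Accepts (v : Variant) (I : Iter n p m) (τ : ℝ) (x' : Euc n) (y' : Dual p m) : Prop :=
  testFun P φp φd c v I τ x' y'
    ≤ -(c.δ / τ) * bregman φp x' I.x - c.δ / (I.γ * τ) * bregman φd y' I.y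

end Step

/-- The sequence `a_{-1}, a_0, a_1, …`, so that `shift aInit a k = a_{k-1}`, where `aInit` is `a_{-1}`. -/
def shift {T : Type*} (aInit : T) (a : ℕ → T) : ℕ → T
  | 0 => aInit
  | k + 1 => a k

/-- The sequences produced by the algorithm: `x^k`, `y^k`, the accepted step sizes `τ_k`,
and `γ_k`. -/
structure Trace (n p m : ℕ) where
  x : ℕ → Euc n
  y : ℕ → Dual p m
  τ : ℕ → ℝ
  γ : ℕ → ℝ

namespace Trace

variable {n p m : ℕ} (r : Trace n p m) (c : Params)

/-- `σ_k = γ_k τ_k`. -/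
def σ (k : ℕ) : ℝ := r.γ k * r.τ k

/-- `t_k = σ_k / σ_0`. -/
def t (k : ℕ) : ℝ := r.σ k / r.σ 0

/-- `T_K = t_0 + ⋯ + t_{K-1}`. -/
def T (K : ℕ) : ℝ := ∑ k ∈ Finset.range K, r.t k

/-- The averaged primal iterate `x̄^K = T_K⁻¹ (t_0 x^1 + ⋯ + t_{K-1} x^K)`. -/
def xbar (K : ℕ) : Euc n := (r.T K)⁻¹ • ∑ k ∈ Finset.range K, r.t k • r.x (k + 1)

/-- `τ_{k-1}`, with `τ_{-1} = τbar`. -/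
def τPrev : ℕ → ℝ := shift c.τbar r.τ

/-- `σ_{k-1}`, with `σ_{-1} = γ₀ τbar`. -/
def σPrev : ℕ → ℝ := shift (c.γ₀ * c.τbar) r.σ

/-- The data at the start of iteration `k`; `(x^{-1}, y^{-1}) = (x^0, y^0)`, and `α_0`, `β_0` are
given by the formulas for `α_{k+1}`, `β_{k+1}` at `k = -1`. -/
def iter (v : Variant) (k : ℕ) : Iter n p m where
  x := r.x k
  xPrev := shift (r.x 0) r.x k
  y := r.y k
  yPrev := shift (r.y 0) r.y k
  γ := r.γ k
  σPrev := r.σPrev c k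
  α := nextα c v (r.τPrev c k) (r.σPrev c k)
  β := nextβ c v (r.σPrev c k)

/-- The first trial step size of iteration `k`: `τbar` for `k = 0`, and
`τ_k √(γ_k / γ_{k+1} (1 + c_nm τ_k / τ_{k-1}))` in iteration `k + 1`. -/
def τInit : ℕ → ℝ
  | 0 => c.τbar
  | k + 1 => r.τ k * √(r.γ k / r.γ (k + 1) * (1 + c.cnm * (r.τ k / r.τPrev c k)))

end Trace

/-- `r` is an infinite run of the algorithm from `(x₀, y₀)`: in iteration `k` the trial step sizes
`τInit`, `η τInit`, `η² τInit`, … are tried in turn; `τ_k` is the first one whose candidate is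
accepted, and that candidate is `(x^{k+1}, y^{k+1})`. -/
structure IsRun {n p m : ℕ} (P : Problem n p m) (φp : Euc n → ℝ) (φd : Dual p m → ℝ) (μ : ℝ)
    (c : Params) (v : Variant) (x₀ : Euc n) (y₀ : Dual p m) (r : Trace n p m) : Prop where
  x_zero : r.x 0 = x₀
  y_zero : r.y 0 = y₀
  γ_zero : r.γ 0 = c.γ₀
  γ_succ : ∀ k, r.γ (k + 1) = r.γ k * (1 + μ * r.τ k)
  backtrack : ∀ k, ∃ j : ℕ, r.τ k = c.η ^ j * r.τInit c k ∧
    (∀ i < j, ∀ x' y', IsCandidate P φp φd v (r.iter c v k) (c.η ^ i * r.τInit c k) x' y' →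
      ¬ Accepts P φp φd c v (r.iter c v k) (c.η ^ i * r.τInit c k) x' y')
  candidate : ∀ k, IsCandidate P φp φd v (r.iter c v k) (r.τ k) (r.x (k + 1)) (r.y (k + 1))
  accepted : ∀ k, Accepts P φp φd c v (r.iter c v k) (r.τ k) (r.x (k + 1)) (r.y (k + 1))

end APDB

end

/-! Both variants rest on an energy inequality: for any reference pair (x, y), an accepted step
bounds σ_k (Φ(x^{k+1}, y) − Φ(x, y^{k+1})) by the drop of an energy built from Bregman distances.
The proximal inequalities produce the distances, the momentum term telescopes up to a remainder
treated by Young's inequality, and the acceptance test pays for the errors (`xyEnergy_next`,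
`yxEnergy_next`). Summation and averaging (Jensen in x, affinity in y) give Φ(x̄^K, y) − f⋆ ≤ C /
T_K uniformly over a ball of multipliers (`exists_gap_bound`). When the radius exceeds the norm of
an optimal multiplier, testing with the multiplier that points along the conic residual controls
both infeasibility and suboptimality (`residual_bound_of_gap`).

The variants differ in their use of strong convexity. In xy the gradient inequality is applied at
x^{k+1}, and its μ-term is exactly what raises the weight γ_k to γ_{k+1}. In yx it is applied at
x^k, so raising the weight leaves errors σ_k (μ/2)‖x − x^{k+1}‖². They are absorbed only after
averaging, with midpoints as reference points (`exists_gap_bound_yx`).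

For the growth of T_K, Lipschitz estimates show that a trial step is accepted once γ_k τ² is small
(`exists_accepts`). So backtracking stops, and along a run with bounded dual iterates γ_k τ_k² stays
bounded below (`exists_step_lower_bound`). The ball bounds the dual iterates in yx; in xy the energy
at a saddle point does. If μ = 0, then γ_k is constant and σ_k is bounded below; if μ > 0, the
recursion γ_{k+1} = γ_k + μσ_k forces σ_k to grow linearly. -/

noncomputable section

namespace APDB

/-! ### Bregman distances and proximal steps -/

section

section Bregman

variable {E : Type*} [NormedAddCommGroup E] [InnerProductSpace ℝ E] [CompleteSpace E]

/-- The gradient inequality of a strongly convex function. -/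
theorem StrongConvexOn.gradient_inequality {S : Set E} {m : ℝ} {φ : E → ℝ} {g x u : E}
    (h : StrongConvexOn S m φ) (hg : HasGradientAt φ g x) (hx : x ∈ S) (hu : u ∈ S) :
    φ x + ⟪g, u - x⟫_ℝ + m / 2 * ‖u - x‖ ^ 2 ≤ φ u := by
  have hline : HasDerivAt (fun t : ℝ => x + t • (u - x)) (u - x) 0 := by
    simpa using ((hasDerivAt_id (0 : ℝ)).smul_const (u - x)).const_add x
  have hd : HasDerivAt (fun t : ℝ => φ (x + t • (u - x))) ⟪g, u - x⟫_ℝ 0 := by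
    have hg' : HasFDerivAt φ (InnerProductSpace.toDual ℝ E g) (x + (0 : ℝ) • (u - x)) := by
      simpa using hg.hasFDerivAt
    simpa using! hg'.comp_hasDerivAt (0 : ℝ) hline
  have ht := hd.tendsto_slope_zero_right
  -- The strong convexity inequality at weight t, divided by t, keeps a factor 1 − t on the
  -- quadratic term; it disappears as t → 0⁺.
  have hr : Filter.Tendsto (fun t : ℝ => φ u - φ x - (1 - t) * (m / 2 * ‖u - x‖ ^ 2))
      (nhdsWithin 0 (Ioi 0)) (nhds (φ u - φ x - (1 - 0) * (m / 2 * ‖u - x‖ ^ 2))) := by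
    apply Filter.Tendsto.mono_left _ nhdsWithin_le_nhds
    apply Continuous.tendsto (f := fun t : ℝ => φ u - φ x - (1 - t) * (m / 2 * ‖u - x‖ ^ 2))
    fun_prop
  have key : ⟪g, u - x⟫_ℝ ≤ φ u - φ x - (1 - 0) * (m / 2 * ‖u - x‖ ^ 2) := by
    refine le_of_tendsto_of_tendsto ht hr ?_
    have hmem : Ioo (0 : ℝ) 1 ∈ nhdsWithin (0 : ℝ) (Ioi 0) := Ioo_mem_nhdsGT one_pos
    filter_upwards [hmem] with t ht
    have h1 := h.2 hx hu (sub_nonneg.2 ht.2.le) ht.1.le (by ring)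
    have h2 : (1 - t) • x + t • u = x + t • (u - x) := by module
    rw [h2, norm_sub_rev] at h1
    simp only [smul_eq_mul, zero_add, zero_smul, add_zero] at h1 ⊢
    rw [inv_mul_le_iff₀ ht.1]
    nlinarith [h1]
  linarith

/-- First-order optimality of a differentiable function over a convex set. -/
theorem IsArgmin.variational {S : Set E} {F : E → ℝ} {g u w : E} (h : IsArgmin F S u)
    (hS : Convex ℝ S) (hg : HasGradientAt F g u) (hw : w ∈ S) : 0 ≤ ⟪g, w - u⟫_ℝ := by
  have hmin : IsLocalMinOn F S u :=
    IsMinOn.localize (fun z hz => h.2 z hz)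
  have := hmin.hasFDerivWithinAt_nonneg hg.hasFDerivAt.hasFDerivWithinAt
    (mem_posTangentConeAt_of_segment_subset (y := w - u)
      (by simpa using hS.segment_subset h.1 hw))
  simpa using this

variable {φ : E → ℝ} {S : Set E}

namespace IsDistGen

theorem hasGradientAt (h : IsDistGen φ S) {w : E} (hw : w ∈ S) :
    HasGradientAt φ (gradient φ w) w := by
  obtain ⟨U, hU, hSU, hd⟩ := h.differentiable
  exact (hd.differentiableAt (hU.mem_nhds (hSU hw))).hasGradientAt

theorem mono {T : Set E} (h : IsDistGen φ S) (hT : T ⊆ S) : IsDistGen φ T := by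
  obtain ⟨U, hU, hSU, hd⟩ := h.differentiable
  obtain ⟨L, hL, hl⟩ := h.lipschitz
  exact ⟨h.strongConvex, ⟨U, hU, hT.trans hSU, hd⟩,
    ⟨L, hL, fun u hu w hw => hl u (hT hu) w (hT hw)⟩⟩

theorem le_bregman (h : IsDistGen φ S) {u w : E} (hw : w ∈ S) :
    1 / 2 * ‖u - w‖ ^ 2 ≤ bregman φ u w := by
  have := StrongConvexOn.gradient_inequality h.strongConvex (h.hasGradientAt hw) (mem_univ w)
    (mem_univ u)
  unfold bregman
  linarith

theorem bregman_nonneg (h : IsDistGen φ S) {u w : E} (hw : w ∈ S) : 0 ≤ bregman φ u w :=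
  le_trans (by positivity) (h.le_bregman hw)

/-- Convexity at u gives D(u, w) ≤ ⟪∇φ u − ∇φ w, u − w⟫, and the Lipschitz bound on `S` finishes;
the segment from w to u is not used. -/
theorem exists_bregman_le (h : IsDistGen φ S) :
    ∃ L : ℝ, 0 < L ∧ ∀ u ∈ S, ∀ w ∈ S, bregman φ u w ≤ L * ‖u - w‖ ^ 2 := by
  obtain ⟨L, hL, hl⟩ := h.lipschitz
  refine ⟨L, hL, fun u hu w hw => ?_⟩
  have h1 := StrongConvexOn.gradient_inequality h.strongConvex (h.hasGradientAt hu) (mem_univ u)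
    (mem_univ w)
  have h2 : ⟪gradient φ u - gradient φ w, u - w⟫_ℝ ≤ L * ‖u - w‖ * ‖u - w‖ :=
    (real_inner_le_norm _ _).trans (mul_le_mul_of_nonneg_right (hl u hu w hw) (norm_nonneg _))
  have h3 : ⟪gradient φ u, w - u⟫_ℝ = -⟪gradient φ u, u - w⟫_ℝ := by
    rw [← inner_neg_right, neg_sub]
  rw [inner_sub_left] at h2
  have h4 : 0 ≤ 1 / 2 * ‖w - u‖ ^ 2 := by positivity
  unfold bregman
  nlinarith

theorem continuousOn (h : IsDistGen φ S) : ContinuousOn φ S := fun _ hw =>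
  (h.hasGradientAt hw).continuousAt.continuousWithinAt

end IsDistGen

theorem bregman_three_point (φ : E → ℝ) (u u' w : E) :
    ⟪gradient φ u' - gradient φ w, u - u'⟫_ℝ
      = bregman φ u w - bregman φ u u' - bregman φ u' w := by
  have h : u - w = (u - u') + (u' - w) := by abel
  simp only [bregman, h, inner_sub_left, inner_add_right]
  ring

theorem bregman_self (φ : E → ℝ) (u : E) : bregman φ u u = 0 := by simp [bregman]

/-- The variational inequality of a Bregman proximal step. -/
theorem IsArgmin.prox_variational {s u' w : E} {c : ℝ} (h : IsDistGen φ S) (hS : Convex ℝ S)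
    (hmin : IsArgmin (fun u => ⟪s, u⟫_ℝ + c * bregman φ u w) S u') {u : E} (hu : u ∈ S) :
    0 ≤ ⟪s + c • (gradient φ u' - gradient φ w), u - u'⟫_ℝ := by
  refine hmin.variational hS ?_ hu
  have h1 : HasFDerivAt (fun u => φ u - φ w - ⟪gradient φ w, u - w⟫_ℝ)
      (InnerProductSpace.toDual ℝ E (gradient φ u') - InnerProductSpace.toDual ℝ E (gradient φ w))
      u' := by
    refine ((h.hasGradientAt hmin.1).hasFDerivAt.sub_const _).sub ?_
    simp only [inner_sub_right]
    exact ((InnerProductSpace.toDual ℝ E (gradient φ w)).hasFDerivAt (x := u')).sub_const _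
  have h2 := ((InnerProductSpace.toDual ℝ E s).hasFDerivAt (x := u')).add (h1.const_mul c)
  rw [hasGradientAt_iff_hasFDerivAt]
  simpa [bregman] using! h2

/-- A Bregman proximal step over a closed set exists. -/
theorem exists_prox [ProperSpace E] (h : IsDistGen φ S) (hS : IsClosed S) {w : E} (hw : w ∈ S)
    (s : E) {c : ℝ} (hc : 0 < c) :
    ∃ u', IsArgmin (fun u => ⟪s, u⟫_ℝ + c * bregman φ u w) S u' := by
  set F : E → ℝ := fun u => ⟪s, u⟫_ℝ + c * bregman φ u w with hF
  have hcont : ContinuousOn F S := by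
    have := h.continuousOn
    simp only [hF, bregman]
    fun_prop
  -- Beyond this radius the quadratic lower bound of c·D dominates the linear term, so the objective
  -- is at least its value at `w`.
  set R : ℝ := 2 * ‖s‖ / c
  have hR : 0 ≤ R := by positivity
  have hcompact : IsCompact (S ∩ Metric.closedBall w R) :=
    (isCompact_closedBall w R).inter_left hS
  obtain ⟨u', hu', hmin⟩ := hcompact.exists_isMinOn ⟨w, hw, Metric.mem_closedBall_self hR⟩
    (hcont.mono inter_subset_left)
  refine ⟨u', hu'.1, fun z hz => ?_⟩
  by_cases hzR : z ∈ Metric.closedBall w R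
  · exact hmin ⟨hz, hzR⟩
  · have h1 : F u' ≤ F w := hmin ⟨hw, Metric.mem_closedBall_self hR⟩
    refine h1.trans ?_
    rw [Metric.mem_closedBall, not_le, dist_eq_norm] at hzR
    have h2 := h.le_bregman (u := z) hw
    have h3 : -(‖s‖ * ‖z - w‖) ≤ ⟪s, z - w⟫_ℝ := neg_le_of_abs_le (abs_real_inner_le_norm _ _)
    rw [inner_sub_right] at h3
    have h4 : ‖s‖ * ‖z - w‖ ≤ c * (1 / 2 * ‖z - w‖ ^ 2) := by
      have : 2 * ‖s‖ < ‖z - w‖ * c := by rwa [div_lt_iff₀ hc] at hzR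
      nlinarith [norm_nonneg (z - w)]
    have h5 := mul_le_mul_of_nonneg_left h2 hc.le
    simp only [hF, bregman_self]
    linarith

theorem gradient_half_norm_sq (x : E) : gradient (fun x : E => 1 / 2 * ‖x‖ ^ 2) x = x := by
  apply HasGradientAt.gradient
  rw [hasGradientAt_iff_hasFDerivAt]
  have := (hasStrictFDerivAt_norm_sq x).hasFDerivAt.const_mul (1 / 2 : ℝ)
  convert! this using 1
  ext y
  simp

theorem bregman_half_norm_sq {φ : E → ℝ} (hφ : ∀ x, φ x = 1 / 2 * ‖x‖ ^ 2) (u w : E) :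
    bregman φ u w = 1 / 2 * ‖u - w‖ ^ 2 := by
  obtain rfl : φ = fun x => 1 / 2 * ‖x‖ ^ 2 := funext hφ
  simp only [bregman, gradient_half_norm_sq, inner_sub_right, norm_sub_sq_real,
    real_inner_self_eq_norm_sq, real_inner_comm u w]
  ring

end Bregman

end

/-! ### The Lagrangian: residual, gradients, Lipschitz constants -/

section

namespace Problem

variable {n p m : ℕ} (P : Problem n p m)

/-- The full residual `(A x - b, g x)`. -/
def res (x : Euc n) : Dual p m := WithLp.toLp 2 (P.eqRes x, P.g x)

theorem Φ_eq (x : Euc n) (y : Dual p m) : P.Φ x y = P.f x + ⟪y, P.res x⟫_ℝ := by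
  simp [Φ, res, add_assoc]

theorem Φ_sub_right (x : Euc n) (y w : Dual p m) :
    P.Φ x y - P.Φ x w = ⟪y - w, P.res x⟫_ℝ := by
  rw [Φ_eq, Φ_eq, inner_sub_left]
  ring

theorem gradY_eq (x : Euc n) (y : Dual p m) : P.gradY x y = P.res x := by
  apply HasGradientAt.gradient
  rw [hasGradientAt_iff_hasFDerivAt]
  have h : (fun w => P.Φ x w) = fun w => P.f x + InnerProductSpace.toDual ℝ _ (P.res x) w := by
    funext w
    rw [Φ_eq, InnerProductSpace.toDual_apply_apply, real_inner_comm]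
  rw [h]
  exact ((InnerProductSpace.toDual ℝ _ (P.res x)).hasFDerivAt).const_add _

theorem eqRes_affine {a c : ℝ} (h : a + c = 1) (x u : Euc n) :
    P.eqRes (a • x + c • u) = a • P.eqRes x + c • P.eqRes u := by
  simp only [eqRes, map_add, map_smul, smul_sub]
  have : P.b = a • P.b + c • P.b := by rw [← add_smul, h, one_smul]
  nth_rewrite 1 [this]
  abel

theorem convex_Y : Convex ℝ P.Y := by
  intro x hx u hu a c ha hc _
  exact (ProperCone.innerDual (P.K : Set (Euc m))).convex hx hu ha hc ‹_›

theorem isClosed_Y : IsClosed P.Y := by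
  have h : Continuous fun y : Dual p m => y.snd := by fun_prop
  exact (ProperCone.innerDual (P.K : Set (Euc m))).isClosed.preimage h

theorem zero_mem_Y : (0 : Dual p m) ∈ P.Y :=
  zero_mem (ProperCone.innerDual (P.K : Set (Euc m)))

theorem smul_mem_Y {y : Dual p m} (hy : y ∈ P.Y) {a : ℝ} (ha : 0 ≤ a) : a • y ∈ P.Y :=
  (ProperCone.innerDual (P.K : Set (Euc m))).smul_mem hy ha

theorem inner_nonneg_of_mem_Y {y : Dual p m} (hy : y ∈ P.Y) {w : Euc m} (hw : w ∈ P.K) :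
    0 ≤ ⟪y.snd, w⟫_ℝ := by
  rw [real_inner_comm]
  exact ProperCone.mem_innerDual.1 hy hw

theorem inner_res_nonpos {x : Euc n} (hx : x ∈ P.feasible) {y : Dual p m} (hy : y ∈ P.Y) :
    ⟪y, P.res x⟫_ℝ ≤ 0 := by
  have h := P.inner_nonneg_of_mem_Y hy hx.2.2
  rw [inner_neg_right] at h
  have h2 := hx.2.1
  simp only [res, WithLp.prod_inner_apply, h2, inner_zero_right]
  change 0 + ⟪y.snd, P.g x⟫_ℝ ≤ 0
  linarith

variable {P}

theorem FunctionsOK.res_convex {μ : ℝ} (hf : P.FunctionsOK μ) {y : Dual p m} (hy : y ∈ P.Y)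
    {x u : Euc n} (hx : x ∈ P.X) (hu : u ∈ P.X) {a c : ℝ} (ha : 0 ≤ a) (hc : 0 ≤ c)
    (hac : a + c = 1) :
    ⟪y, P.res (a • x + c • u)⟫_ℝ ≤ a * ⟪y, P.res x⟫_ℝ + c * ⟪y, P.res u⟫_ℝ := by
  have h := P.inner_nonneg_of_mem_Y hy (hf.convex_g x hx u hu a c ha hc hac)
  simp only [inner_sub_right, inner_add_right, inner_smul_right] at h
  simp only [res, WithLp.prod_inner_apply, P.eqRes_affine hac, inner_add_right, inner_smul_right]
  change _ + ⟪y.snd, _⟫_ℝ ≤ a * (_ + ⟪y.snd, _⟫_ℝ) + c * (_ + ⟪y.snd, _⟫_ℝ)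
  linarith

theorem FunctionsOK.strongConvexOn_Φ {μ : ℝ} (hf : P.FunctionsOK μ) {y : Dual p m}
    (hy : y ∈ P.Y) : StrongConvexOn P.X μ (fun x => P.Φ x y) := by
  refine ⟨hf.convex_f.1, fun x hx u hu a c ha hc hac => ?_⟩
  have h1 := hf.convex_f.2 hx hu ha hc hac
  have h2 := hf.res_convex hy hx hu ha hc hac
  simp only [Φ_eq, smul_eq_mul] at h1 ⊢
  linarith

theorem FunctionsOK.hasGradientAt_f {μ : ℝ} (hf : P.FunctionsOK μ) {x : Euc n} (hx : x ∈ P.X) :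
    HasGradientAt P.f (gradient P.f x) x := by
  obtain ⟨U, hU, hXU, h1, -⟩ := hf.smooth
  exact ((h1.contDiffAt (hU.mem_nhds (hXU hx))).differentiableAt one_ne_zero).hasGradientAt

/-- The derivative of the residual. -/
def resDeriv (P : Problem n p m) (x : Euc n) : Euc n →L[ℝ] Dual p m :=
  ((WithLp.prodContinuousLinearEquiv 2 ℝ (Euc p) (Euc m)).symm : _ →L[ℝ] Dual p m).comp
    ((LinearMap.toContinuousLinearMap P.A.toEuclideanLin).prod (fderiv ℝ P.g x))

theorem FunctionsOK.hasFDerivAt_res {μ : ℝ} (hf : P.FunctionsOK μ) {x : Euc n} (hx : x ∈ P.X) :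
    HasFDerivAt P.res (P.resDeriv x) x := by
  obtain ⟨U, hU, hXU, -, h1⟩ := hf.smooth
  have h2 := ((h1.contDiffAt (hU.mem_nhds (hXU hx))).differentiableAt one_ne_zero).hasFDerivAt
  have h3 : HasFDerivAt P.eqRes (LinearMap.toContinuousLinearMap P.A.toEuclideanLin) x :=
    (LinearMap.toContinuousLinearMap P.A.toEuclideanLin).hasFDerivAt.sub_const _
  exact ((WithLp.prodContinuousLinearEquiv 2 ℝ (Euc p) (Euc m)).symm.hasFDerivAt).comp x
    (h3.prodMk h2)

theorem FunctionsOK.hasGradientAt_Φ {μ : ℝ} (hf : P.FunctionsOK μ) {x : Euc n} (hx : x ∈ P.X)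
    (y : Dual p m) :
    HasGradientAt (fun u => P.Φ u y)
      (gradient P.f x + ContinuousLinearMap.adjoint (P.resDeriv x) y) x := by
  rw [hasGradientAt_iff_hasFDerivAt]
  have h1 := (hf.hasGradientAt_f hx).hasFDerivAt
  have h2 := ((InnerProductSpace.toDual ℝ _ y).hasFDerivAt).comp x (hf.hasFDerivAt_res hx)
  have h3 := h1.add h2
  simp only [Φ_eq]
  refine HasFDerivAt.congr_fderiv h3 ?_
  ext v
  simp [ContinuousLinearMap.adjoint_inner_left]

theorem FunctionsOK.gradX_eq {μ : ℝ} (hf : P.FunctionsOK μ) {x : Euc n} (hx : x ∈ P.X)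
    (y : Dual p m) :
    P.gradX x y = gradient P.f x + ContinuousLinearMap.adjoint (P.resDeriv x) y :=
  (hf.hasGradientAt_Φ hx y).gradient

theorem FunctionsOK.gradX_inequality {μ : ℝ} (hf : P.FunctionsOK μ) {x u : Euc n} (hx : x ∈ P.X)
    (hu : u ∈ P.X) {y : Dual p m} (hy : y ∈ P.Y) :
    P.Φ x y + ⟪P.gradX x y, u - x⟫_ℝ + μ / 2 * ‖u - x‖ ^ 2 ≤ P.Φ u y := by
  have h := hf.hasGradientAt_Φ hx y
  rw [← hf.gradX_eq hx] at h
  exact StrongConvexOn.gradient_inequality (hf.strongConvexOn_Φ hy) h hx hu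

/-- The block `A` of the derivative is constant and cancels, which leaves only the derivative of
`g`. -/
theorem norm_resDeriv_sub_le (P : Problem n p m) (x u : Euc n) :
    ‖P.resDeriv u - P.resDeriv x‖ ≤ ‖fderiv ℝ P.g u - fderiv ℝ P.g x‖ := by
  refine ContinuousLinearMap.opNorm_le_bound _ (norm_nonneg _) fun v => ?_
  have h : (P.resDeriv u - P.resDeriv x) v
      = WithLp.toLp 2 ((0 : Euc p), (fderiv ℝ P.g u - fderiv ℝ P.g x) v) := by
    simp [resDeriv, ← WithLp.toLp_sub]
  rw [h, WithLp.norm_toLp_snd]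
  exact ContinuousLinearMap.le_opNorm _ _

/-- Common Lipschitz constants of the partial gradients and of the residual on `X`. -/
theorem FunctionsOK.exists_lipschitz {μ : ℝ} (hf : P.FunctionsOK μ) (hs : P.SetsOK) :
    ∃ L : ℝ, 0 < L ∧
      (∀ x ∈ P.X, ∀ u ∈ P.X, ∀ y, ‖P.gradX u y - P.gradX x y‖ ≤ L * (1 + ‖y‖) * ‖u - x‖) ∧
      (∀ x ∈ P.X, ∀ y w, ‖P.gradX x y - P.gradX x w‖ ≤ L * ‖y - w‖) ∧
      (∀ x ∈ P.X, ∀ u ∈ P.X, ‖P.res u - P.res x‖ ≤ L * ‖u - x‖) := by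
  rcases P.X.eq_empty_or_nonempty with he | ⟨x₀, hx₀⟩
  · refine ⟨1, one_pos, ?_, ?_, ?_⟩ <;> simp [he]
  obtain ⟨Lf, hLf, hf1⟩ := hf.lipschitz_f
  obtain ⟨Lg, hLg, hg1⟩ := hf.lipschitz_g
  obtain ⟨R, hR⟩ := (Metric.isBounded_iff.1 hs.compact_X.isBounded)
  have hR0 : 0 ≤ R := le_trans dist_nonneg (hR hx₀ hx₀)
  -- A Lipschitz derivative on a bounded set is bounded: compare with the base point `x₀`, using the
  -- diameter bound `R`.
  set M := ‖P.resDeriv x₀‖ + Lg * R with hM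
  have hM0 : 0 ≤ M := by positivity
  have hbound : ∀ x ∈ P.X, ‖P.resDeriv x‖ ≤ M := by
    intro x hx
    have h1 := (P.norm_resDeriv_sub_le x₀ x).trans (hg1 x₀ hx₀ x hx)
    have h2 : ‖x - x₀‖ ≤ R := by rw [← dist_eq_norm]; exact hR hx hx₀
    have h3 : ‖P.resDeriv x‖ ≤ ‖P.resDeriv x₀‖ + ‖P.resDeriv x - P.resDeriv x₀‖ := by
      simpa using norm_add_le (P.resDeriv x₀) (P.resDeriv x - P.resDeriv x₀)
    nlinarith [mul_le_mul_of_nonneg_left h2 hLg]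
  refine ⟨Lf + Lg + M + 1, by positivity, ?_, ?_, ?_⟩
  · intro x hx u hu y
    rw [hf.gradX_eq hx, hf.gradX_eq hu]
    have h1 : gradient P.f u + ContinuousLinearMap.adjoint (P.resDeriv u) y
        - (gradient P.f x + ContinuousLinearMap.adjoint (P.resDeriv x) y)
        = (gradient P.f u - gradient P.f x)
          + ContinuousLinearMap.adjoint (P.resDeriv u - P.resDeriv x) y := by
      rw [map_sub]
      simp only [sub_apply]
      abel
    rw [h1]
    have h2 : ‖ContinuousLinearMap.adjoint (P.resDeriv u - P.resDeriv x) y‖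
        ≤ Lg * ‖u - x‖ * ‖y‖ := by
      refine (ContinuousLinearMap.le_opNorm _ _).trans ?_
      rw [LinearIsometryEquiv.norm_map]
      exact mul_le_mul_of_nonneg_right ((P.norm_resDeriv_sub_le x u).trans (hg1 x hx u hu))
        (norm_nonneg _)
    have h3 := norm_add_le (gradient P.f u - gradient P.f x)
      (ContinuousLinearMap.adjoint (P.resDeriv u - P.resDeriv x) y)
    have h4 := hf1 x hx u hu
    have h5 : 0 ≤ ‖u - x‖ * ‖y‖ := by positivity
    nlinarith [norm_nonneg (u - x), norm_nonneg y, mul_nonneg hLf h5, mul_nonneg hM0 h5,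
      mul_nonneg hM0 (norm_nonneg (u - x)), mul_nonneg hLg (norm_nonneg (u - x))]
  · intro x hx y w
    rw [hf.gradX_eq hx, hf.gradX_eq hx, add_sub_add_left_eq_sub, ← map_sub]
    refine (ContinuousLinearMap.le_opNorm _ _).trans ?_
    rw [LinearIsometryEquiv.norm_map]
    refine mul_le_mul_of_nonneg_right ?_ (norm_nonneg _)
    linarith [hbound x hx]
  · intro x hx u hu
    refine (hs.convex_X.norm_image_sub_le_of_norm_hasFDerivWithin_le
      (fun z hz => (hf.hasFDerivAt_res hz).hasFDerivWithinAt) hbound hx hu).trans ?_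
    refine mul_le_mul_of_nonneg_right ?_ (norm_nonneg _)
    linarith

end Problem

end

/-! ### Saddle points, and from Lagrangian gaps to conic residuals -/

section

namespace Problem

variable {n p m : ℕ} {P : Problem n p m}

/-- Moreau decomposition of the residual along the cone {0} × (−K): `e` is the residual minus its
projection `q`, hence orthogonal to `q` and in the polar cone, which is `P.Y`. It is the direction
in which a multiplier penalizes infeasibility most. -/
theorem exists_residual_multiplier (P : Problem n p m) (x : Euc n) :
    ∃ e ∈ P.Y, P.infeas x ≤ ‖e‖ ∧ ⟪e, P.res x⟫_ℝ = ‖e‖ ^ 2 ∧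
      ∀ y ∈ P.Y, ⟪y, P.res x⟫_ℝ ≤ ‖y‖ * ‖e‖ := by
  set S : Set (Dual p m) := {w | w.fst = 0 ∧ -w.snd ∈ P.K} with hS
  have hS0 : (0 : Dual p m) ∈ S := by
    refine ⟨rfl, ?_⟩
    change -(0 : Euc m) ∈ P.K
    rw [neg_zero]
    exact zero_mem P.K
  have hSsmul : ∀ w ∈ S, ∀ a : ℝ, 0 ≤ a → a • w ∈ S := by
    intro w hw a ha
    refine ⟨?_, ?_⟩
    · change a • w.fst = 0
      rw [hw.1, smul_zero]
    · change -(a • w.snd) ∈ P.K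
      rw [← smul_neg]
      exact P.K.smul_mem hw.2 ha
  have hSadd : ∀ w ∈ S, ∀ u ∈ S, w + u ∈ S := by
    intro w hw u hu
    refine ⟨?_, ?_⟩
    · change w.fst + u.fst = 0
      rw [hw.1, hu.1, add_zero]
    · change -(w.snd + u.snd) ∈ P.K
      rw [neg_add]
      exact add_mem hw.2 hu.2
  have hSconv : Convex ℝ S := fun w hw u hu a c ha hc _ =>
    hSadd _ (hSsmul w hw a ha) _ (hSsmul u hu c hc)
  have hSclosed : IsClosed S := by
    have h1 : Continuous fun y : Dual p m => y.fst := by fun_prop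
    have h2 : Continuous fun y : Dual p m => -y.snd := by fun_prop
    exact (isClosed_singleton.preimage h1).inter (P.K.isClosed.preimage h2)
  obtain ⟨q, hqS, hq⟩ := exists_norm_eq_iInf_of_complete_convex ⟨0, hS0⟩ hSclosed.isComplete
    hSconv (P.res x)
  have hvar := (norm_eq_iInf_iff_real_inner_le_zero hSconv hqS).1 hq
  set e := P.res x - q with he
  have hres : P.res x = e + q := by rw [he]; abel
  have hle : ∀ w ∈ S, ⟪e, w⟫_ℝ ≤ 0 := by
    intro w hw
    have := hvar (q + w) (hSadd q hqS w hw)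
    simpa using this
  have heq : ⟪e, q⟫_ℝ = 0 := by
    refine le_antisymm (hle q hqS) ?_
    have := hvar 0 hS0
    rw [zero_sub, inner_neg_right] at this
    linarith
  refine ⟨e, ?_, ?_, ?_, ?_⟩
  · refine ProperCone.mem_innerDual.2 fun w hw => ?_
    have h := hle (WithLp.toLp 2 ((0 : Euc p), -w)) ⟨rfl, by simpa using hw⟩
    simp only [WithLp.prod_inner_apply, inner_zero_right, inner_neg_right, zero_add] at h
    rw [real_inner_comm]
    change -⟪e.snd, w⟫_ℝ ≤ 0 at h
    linarith
  · have h1 : (WithLp.toLp 2 ((0 : Euc p), -q.snd) : Dual p m) ∈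
        {w : Dual p m | w.fst = 0 ∧ w.snd ∈ P.K} := ⟨rfl, hqS.2⟩
    refine (Metric.infDist_le_dist_of_mem h1).trans (le_of_eq ?_)
    have h2 : (WithLp.toLp 2 (P.eqRes x, -P.g x) - WithLp.toLp 2 ((0 : Euc p), -q.snd) : Dual p m)
        = WithLp.toLp 2 (e.fst, -e.snd) := by
      have h3 : e.fst = P.eqRes x := by
        change P.eqRes x - q.fst = _
        rw [hqS.1, sub_zero]
      have h4 : e.snd = P.g x - q.snd := rfl
      rw [h3, h4, ← WithLp.toLp_sub]
      simp only [Prod.mk_sub_mk, sub_zero, neg_sub, sub_neg_eq_add, neg_add_eq_sub]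
    rw [dist_eq_norm, h2]
    refine (sq_eq_sq₀ (norm_nonneg _) (norm_nonneg _)).1 ?_
    simp only [WithLp.prod_norm_sq_eq_of_L2]
    change ‖e.fst‖ ^ 2 + ‖-e.snd‖ ^ 2 = _
    rw [norm_neg]
  · rw [hres, inner_add_right, heq, add_zero, real_inner_self_eq_norm_sq]
  · intro y hy
    rw [hres, inner_add_right]
    have h1 : ⟪y, q⟫_ℝ ≤ 0 := by
      have h2 := P.inner_nonneg_of_mem_Y hy hqS.2
      have h3 := hqS.1
      rw [inner_neg_right] at h2
      change ⟪y.fst, q.fst⟫_ℝ + ⟪y.snd, q.snd⟫_ℝ ≤ 0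
      rw [h3, inner_zero_right]
      linarith
    linarith [real_inner_le_norm y e]

/-- Complementary slackness: the maximum over the ray through `ys` is attained at an interior point
of the ray, so testing with 0 and 2·`ys` forces the linear term to vanish. -/
theorem isCompl_of_mem_saddle {xs : Euc n} {ys : Dual p m} (h : (xs, ys) ∈ P.saddle) :
    ⟪ys, P.res xs⟫_ℝ = 0 := by
  obtain ⟨-, hy, hmax, -⟩ := h
  have h0 := hmax 0 P.zero_mem_Y
  have h2 := hmax ((2 : ℝ) • ys) (P.smul_mem_Y hy zero_le_two)
  simp only [Φ_eq, inner_zero_left, inner_smul_left, conj_trivial] at h0 h2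
  linarith

theorem inner_res_nonpos_of_mem_saddle {xs : Euc n} {ys y : Dual p m} (h : (xs, ys) ∈ P.saddle)
    (hy : y ∈ P.Y) : ⟪y, P.res xs⟫_ℝ ≤ 0 := by
  have h1 := h.2.2.1 y hy
  have h2 := isCompl_of_mem_saddle h
  simp only [Φ_eq] at h1
  linarith

/-- The residual pairs nonpositively with all of `P.Y`. The free multiplier (A x − b, 0) kills the
equality residual, and the bipolar theorem K** = K gives the conic constraint. -/
theorem feasible_of_mem_saddle {xs : Euc n} {ys : Dual p m} (h : (xs, ys) ∈ P.saddle) :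
    xs ∈ P.feasible := by
  refine ⟨h.1, ?_, ?_⟩
  · have h1 : (WithLp.toLp 2 (P.eqRes xs, (0 : Euc m)) : Dual p m) ∈ P.Y :=
      zero_mem (ProperCone.innerDual (P.K : Set (Euc m)))
    have h2 := inner_res_nonpos_of_mem_saddle h h1
    simpa [res] using h2
  · have h1 : -P.g xs ∈ ProperCone.innerDual
        ((ProperCone.innerDual (P.K : Set (Euc m)) : ProperCone ℝ (Euc m)) : Set (Euc m)) := by
      refine ProperCone.mem_innerDual.2 fun l hl => ?_
      have h2 := inner_res_nonpos_of_mem_saddle (y := WithLp.toLp 2 ((0 : Euc p), l)) h hl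
      simp [res] at h2
      rw [inner_neg_right]
      linarith
    rwa [ProperCone.innerDual_innerDual] at h1

theorem Φ_of_mem_saddle {xs : Euc n} {ys : Dual p m} (h : (xs, ys) ∈ P.saddle) :
    P.Φ xs ys = P.f xs := by
  rw [Φ_eq, isCompl_of_mem_saddle h, add_zero]

theorem f_le_of_mem_saddle {xs x : Euc n} {ys : Dual p m} (h : (xs, ys) ∈ P.saddle)
    (hx : x ∈ P.feasible) : P.f xs ≤ P.f x := by
  have h1 := h.2.2.2 x hx.1
  rw [Φ_of_mem_saddle h, Φ_eq] at h1
  linarith [P.inner_res_nonpos hx h.2.1]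

theorem fStar_eq_of_mem_saddle {xs : Euc n} {ys : Dual p m} (h : (xs, ys) ∈ P.saddle) :
    P.fStar = P.f xs := by
  refine IsLeast.csInf_eq ⟨⟨xs, feasible_of_mem_saddle h, rfl⟩, ?_⟩
  rintro _ ⟨x, hx, rfl⟩
  exact f_le_of_mem_saddle h hx

/-- The multiplier of the given saddle point may lie outside the ball of the yx variant. Strong
duality lets any dual optimal `y` replace it: f(xs) ≤ q(ys) ≤ q(y) ≤ Φ(xs, y) ≤ f(xs). -/
theorem FunctionsOK.mem_saddle_of_mem_dualOpt {μ : ℝ} (hf : P.FunctionsOK μ) (hs : P.SetsOK)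
    {xs : Euc n} {ys y : Dual p m} (h : (xs, ys) ∈ P.saddle) (hy : y ∈ P.dualOpt) :
    (xs, y) ∈ P.saddle := by
  have hbdd : ∀ w, BddBelow ((fun x => P.Φ x w) '' P.X) := fun w =>
    (hs.compact_X.image_of_continuousOn fun x hx =>
      (hf.hasGradientAt_Φ hx w).continuousAt.continuousWithinAt).bddBelow
  have h1 : P.f xs ≤ P.dualFun ys := by
    refine le_csInf ⟨_, mem_image_of_mem _ h.1⟩ ?_
    rintro _ ⟨x, hx, rfl⟩
    rw [← Φ_of_mem_saddle h]
    exact h.2.2.2 x hx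
  have h2 : ∀ x ∈ P.X, P.f xs ≤ P.Φ x y := fun x hx =>
    (h1.trans (hy.2 ys h.2.1)).trans (csInf_le (hbdd y) (mem_image_of_mem _ hx))
  have h3 : P.Φ xs y = P.f xs := by
    refine le_antisymm ?_ (h2 xs h.1)
    rw [Φ_eq]
    linarith [inner_res_nonpos_of_mem_saddle h hy.1]
  refine ⟨h.1, hy.1, fun w hw => ?_, fun x hx => ?_⟩
  · rw [h3, Φ_eq]
    linarith [inner_res_nonpos_of_mem_saddle h hw]
  · rw [h3]
    exact h2 x hx

theorem FunctionsOK.inner_gradX_nonneg_of_mem_saddle {μ : ℝ} (hf : P.FunctionsOK μ)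
    (hs : P.SetsOK) {xs x : Euc n} {ys : Dual p m} (h : (xs, ys) ∈ P.saddle) (hx : x ∈ P.X) :
    0 ≤ ⟪P.gradX xs ys, x - xs⟫_ℝ := by
  have h1 := hf.hasGradientAt_Φ h.1 ys
  rw [← hf.gradX_eq h.1] at h1
  exact IsArgmin.variational (F := fun u => P.Φ u ys) ⟨h.1, h.2.2.2⟩ hs.convex_X h1 hx

/-- Strong convexity of Φ(·, ys) at its constrained minimizer `xs`; this turns a gap bound at `ys`
into a distance bound. -/
theorem FunctionsOK.growth_of_mem_saddle {μ : ℝ} (hf : P.FunctionsOK μ) (hs : P.SetsOK)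
    {xs x : Euc n} {ys : Dual p m} (h : (xs, ys) ∈ P.saddle) (hx : x ∈ P.X) :
    P.f xs + μ / 2 * ‖x - xs‖ ^ 2 ≤ P.Φ x ys := by
  have h1 := hf.gradX_inequality h.1 hx h.2.1
  rw [Φ_of_mem_saddle h] at h1
  linarith [hf.inner_gradX_nonneg_of_mem_saddle hs h hx]

theorem FunctionsOK.eq_of_mem_primalOpt {μ : ℝ} (hf : P.FunctionsOK μ) (hs : P.SetsOK)
    (hμ : 0 < μ) {xs x : Euc n} {ys : Dual p m} (h : (xs, ys) ∈ P.saddle)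
    (hx : x ∈ P.primalOpt) : x = xs := by
  have h1 := hf.growth_of_mem_saddle hs h hx.1.1
  have h2 := hx.2 xs (feasible_of_mem_saddle h)
  have h3 := P.inner_res_nonpos hx.1 h.2.1
  rw [Φ_eq] at h1
  have h4 : ‖x - xs‖ ^ 2 ≤ 0 := by nlinarith [sq_nonneg ‖x - xs‖]
  have h5 : ‖x - xs‖ = 0 := by
    simpa using le_antisymm h4 (sq_nonneg _)
  exact sub_eq_zero.1 (norm_eq_zero.1 h5)

/-- A bound on the Lagrangian gap over a ball of multipliers larger than `‖y⋆‖` controls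
infeasibility and suboptimality. -/
theorem FunctionsOK.residual_bound_of_gap {xs x : Euc n}
    {ys : Dual p m} (h : (xs, ys) ∈ P.saddle) (hx : x ∈ P.X) {R q : ℝ} (hR : ‖ys‖ < R)
    (hgap : ∀ y ∈ P.Y, ‖y‖ ≤ R → P.Φ x y - P.f xs ≤ q) :
    max (P.infeas x) |P.f x - P.fStar| ≤ q * (1 + (1 + ‖ys‖) / (R - ‖ys‖)) := by
  obtain ⟨e, heY, he1, he2, he3⟩ := P.exists_residual_multiplier x
  have hR0 : 0 ≤ R := (norm_nonneg _).trans hR.le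
  have hd : 0 < R - ‖ys‖ := sub_pos.2 hR
  -- The gap is tested with the multiplier of norm `R` in direction `e`; when `e` = 0 the zero
  -- multiplier suffices.
  have h1 : P.f x - P.f xs + R * ‖e‖ ≤ q := by
    rcases eq_or_ne e 0 with h0 | h0
    · have := hgap 0 P.zero_mem_Y (by simpa using hR0)
      rw [Φ_eq, inner_zero_left] at this
      rw [h0, norm_zero]
      linarith
    · have hn : 0 < ‖e‖ := norm_pos_iff.2 h0
      have := hgap ((R / ‖e‖) • e) (P.smul_mem_Y heY (by positivity))
        (by rw [norm_smul, Real.norm_of_nonneg (by positivity), div_mul_cancel₀ _ hn.ne'])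
      rw [Φ_eq, inner_smul_left, he2] at this
      have h2 : R / ‖e‖ * ‖e‖ ^ 2 = R * ‖e‖ := by field_simp
      simp only [conj_trivial] at this
      linarith
  -- The saddle point gives the matching lower bound, so the penalty weight R exceeds the possible
  -- gain ‖ys‖ per unit of residual.
  have h2 : -(‖ys‖ * ‖e‖) ≤ P.f x - P.f xs := by
    have h3 := h.2.2.2 x hx
    rw [Φ_of_mem_saddle h, Φ_eq] at h3
    linarith [he3 ys h.2.1]
  have h3 : ‖e‖ ≤ q / (R - ‖ys‖) := by
    rw [le_div_iff₀ hd]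
    linarith
  have hq : 0 ≤ q := by
    have := (norm_nonneg e).trans h3
    rw [le_div_iff₀ hd] at this
    linarith
  have h4 : q * (1 + (1 + ‖ys‖) / (R - ‖ys‖))
      = q + q / (R - ‖ys‖) + ‖ys‖ * (q / (R - ‖ys‖)) := by ring
  have h5 : 0 ≤ q / (R - ‖ys‖) := div_nonneg hq hd.le
  have h6 := mul_le_mul_of_nonneg_left h3 (norm_nonneg ys)
  have h7 : 0 ≤ ‖ys‖ * (q / (R - ‖ys‖)) := mul_nonneg (norm_nonneg _) h5
  rw [h4, fStar_eq_of_mem_saddle h]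
  refine max_le (by linarith) (abs_le.2 ⟨by linarith, ?_⟩)
  linarith [mul_nonneg hR0 (norm_nonneg e)]

end Problem

/-! ### Ergodic averages and growth of the weights -/

namespace Trace

variable {n p m : ℕ} {P : Problem n p m} {r : Trace n p m}

theorem σ_zero_mul_T (h0 : r.σ 0 ≠ 0) (K : ℕ) :
    r.σ 0 * r.T K = ∑ k ∈ Finset.range K, r.σ k := by
  rw [T, Finset.mul_sum]
  refine Finset.sum_congr rfl fun k _ => ?_
  rw [t, mul_div_cancel₀ _ h0]

theorem T_pos (hσ : ∀ k, 0 < r.σ k) {K : ℕ} (hK : 1 ≤ K) : 0 < r.T K :=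
  Finset.sum_pos (fun k _ => div_pos (hσ k) (hσ 0)) (Finset.nonempty_range_iff.2 (by omega))

theorem xbar_mem (hX : Convex ℝ P.X) (hx : ∀ k, r.x k ∈ P.X) (hσ : ∀ k, 0 < r.σ k) {K : ℕ}
    (hK : 1 ≤ K) : r.xbar K ∈ P.X := by
  have hT := T_pos hσ hK
  rw [xbar, Finset.smul_sum]
  simp only [smul_smul]
  refine hX.sum_mem (fun k _ => ?_) ?_ fun k _ => hx _
  · exact mul_nonneg (inv_nonneg.2 hT.le) (div_pos (hσ k) (hσ 0)).le
  · rw [← Finset.mul_sum]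
    exact inv_mul_cancel₀ hT.ne'

/-- The averaged dual iterate `ȳ^K = T_K⁻¹ (t_0 y^1 + ⋯ + t_{K-1} y^K)`. -/
def ybar (r : Trace n p m) (K : ℕ) : Dual p m :=
  (r.T K)⁻¹ • ∑ k ∈ Finset.range K, r.t k • r.y (k + 1)

theorem ybar_mem {S : Set (Dual p m)} (hS : Convex ℝ S) (hy : ∀ k, r.y k ∈ S)
    (hσ : ∀ k, 0 < r.σ k) {K : ℕ} (hK : 1 ≤ K) : r.ybar K ∈ S := by
  have hT := T_pos hσ hK
  rw [ybar, Finset.smul_sum]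
  simp only [smul_smul]
  refine hS.sum_mem (fun k _ => ?_) ?_ fun k _ => hy _
  · exact mul_nonneg (inv_nonneg.2 hT.le) (div_pos (hσ k) (hσ 0)).le
  · rw [← Finset.mul_sum]
    exact inv_mul_cancel₀ hT.ne'

/-- Jensen's inequality for the weighted sums of gaps. -/
theorem gap_average_le {F : Euc n → ℝ} (hF : ConvexOn ℝ P.X F) (hx : ∀ k, r.x k ∈ P.X)
    (hσ : ∀ k, 0 < r.σ k) {K : ℕ} (hK : 1 ≤ K) {x : Euc n} {C : ℝ}
    (h : ∑ k ∈ Finset.range K, r.σ k * (F (r.x (k + 1)) - P.Φ x (r.y (k + 1))) ≤ C) :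
    F (r.xbar K) - P.Φ x (r.ybar K) ≤ C / r.σ 0 / r.T K := by
  have hT := T_pos hσ hK
  have hw : ∑ k ∈ Finset.range K, (r.T K)⁻¹ * r.t k = 1 := by
    rw [← Finset.mul_sum]
    exact inv_mul_cancel₀ hT.ne'
  have h1 : F (r.xbar K) ≤ ∑ k ∈ Finset.range K, ((r.T K)⁻¹ * r.t k) * F (r.x (k + 1)) := by
    have := hF.map_sum_le (t := Finset.range K) (w := fun k => (r.T K)⁻¹ * r.t k)
      (p := fun k => r.x (k + 1))
      (fun k _ => mul_nonneg (inv_nonneg.2 hT.le) (div_pos (hσ k) (hσ 0)).le)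
      hw (fun k _ => hx _)
    simpa only [xbar, Finset.smul_sum, smul_smul, smul_eq_mul] using this
  -- Φ is affine in y, so averaging is exact on the dual side; only the convex `F` needs Jensen.
  have h2 : P.Φ x (r.ybar K)
      = ∑ k ∈ Finset.range K, ((r.T K)⁻¹ * r.t k) * P.Φ x (r.y (k + 1)) := by
    simp only [P.Φ_eq, ybar, Finset.smul_sum, smul_smul, sum_inner, real_inner_smul_left, mul_add,
      Finset.sum_add_distrib, ← Finset.sum_mul, hw, one_mul]
  have h3 : ∑ k ∈ Finset.range K, r.σ k * (F (r.x (k + 1)) - P.Φ x (r.y (k + 1)))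
      = r.σ 0 * r.T K * (∑ k ∈ Finset.range K, ((r.T K)⁻¹ * r.t k) * F (r.x (k + 1))
        - ∑ k ∈ Finset.range K, ((r.T K)⁻¹ * r.t k) * P.Φ x (r.y (k + 1))) := by
    rw [← Finset.sum_sub_distrib, Finset.mul_sum]
    refine Finset.sum_congr rfl fun k _ => ?_
    rw [t]
    have := (hσ 0).ne'
    have := hT.ne'
    field_simp
  rw [div_div, le_div_iff₀ (mul_pos (hσ 0) hT), mul_comm, h2]
  rw [h3] at h
  exact (mul_le_mul_of_nonneg_left (sub_le_sub_right h1 _) (mul_pos (hσ 0) hT).le).trans h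

/-- The ergodic rates, given a bound on the Lagrangian gap of the averages. -/
theorem rates_of_gap {μ : ℝ} (hf : P.FunctionsOK μ) (hs : P.SetsOK) (hx : ∀ k, r.x k ∈ P.X)
    (hσ : ∀ k, 0 < r.σ k) {xs : Euc n} {ys : Dual p m}
    (h : (xs, ys) ∈ P.saddle) {R C : ℝ} (hC : 0 ≤ C) (hR : ‖ys‖ < R)
    (hgap : ∀ K, 1 ≤ K → ∀ y ∈ P.Y, ‖y‖ ≤ R → P.Φ (r.xbar K) y - P.f xs ≤ C / r.T K) :
    (∃ C' : ℝ, 0 < C' ∧ ∀ K : ℕ, 1 ≤ K →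
      max (P.infeas (r.xbar K)) |P.f (r.xbar K) - P.fStar| ≤ C' / r.T K) ∧
    (0 < μ → ∃ C' : ℝ, 0 < C' ∧ ∀ K : ℕ, 1 ≤ K → ‖r.xbar K - xs‖ ^ 2 ≤ C' / r.T K) := by
  refine ⟨⟨C * (1 + (1 + ‖ys‖) / (R - ‖ys‖)) + 1, ?_, fun K hK => ?_⟩, fun hμ =>
    ⟨2 / μ * C + 1, by positivity, fun K hK => ?_⟩⟩
  · have := sub_pos.2 hR
    positivity
  · refine (Problem.FunctionsOK.residual_bound_of_gap h (xbar_mem hs.convex_X hx hσ hK) hR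
      (hgap K hK)).trans ?_
    rw [div_mul_eq_mul_div]
    exact div_le_div_of_nonneg_right (by linarith) (T_pos hσ hK).le
  · have h1 := hf.growth_of_mem_saddle hs h (xbar_mem hs.convex_X hx hσ hK)
    have h2 := hgap K hK ys h.2.1 hR.le
    have h3 : ‖r.xbar K - xs‖ ^ 2 ≤ 2 / μ * (C / r.T K) := by
      rw [div_mul_eq_mul_div, le_div_iff₀ hμ]
      nlinarith
    refine h3.trans ?_
    rw [← mul_div_assoc]
    exact div_le_div_of_nonneg_right (by linarith) (T_pos hσ hK).le

theorem linear_growth (hγ : ∀ k, r.γ k = r.γ 0) (hγ0 : 0 < r.γ 0) (hτ : ∀ k, 0 < r.τ k) {c : ℝ}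
    (hc : 0 < c) (h : ∀ k, c ≤ r.γ k * r.τ k ^ 2) :
    ∃ a : ℝ, 0 < a ∧ ∀ K : ℕ, 1 ≤ K → a * (K : ℝ) ≤ r.T K := by
  have hσ0 : 0 < r.σ 0 := mul_pos hγ0 (hτ 0)
  refine ⟨√(c * r.γ 0) / r.σ 0, by positivity, fun K _ => ?_⟩
  have h1 : ∀ k, √(c * r.γ 0) / r.σ 0 ≤ r.t k := by
    intro k
    refine div_le_div_of_nonneg_right ?_ hσ0.le
    refine Real.sqrt_le_iff.2 ⟨by rw [σ, hγ k]; exact (mul_pos hγ0 (hτ k)).le, ?_⟩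
    have := h k
    rw [hγ k] at this
    rw [σ, hγ k]
    nlinarith
  calc _ = ∑ k ∈ Finset.range K, √(c * r.γ 0) / r.σ 0 := by simp [mul_comm]
    _ ≤ _ := Finset.sum_le_sum fun k _ => h1 k

/-- Since σ_k² = (γ_k τ_k²) γ_k ≥ c γ_k, the recursion γ_{k+1} = γ_k + μσ_k makes √γ_k, and with it
σ_k, grow at least linearly. -/
theorem quadratic_growth {μ : ℝ} (hμ : 0 < μ) (hγ : ∀ k, r.γ (k + 1) = r.γ k * (1 + μ * r.τ k))
    (hγ0 : 0 < r.γ 0) (hγp : ∀ k, 0 < r.γ k) (hτ : ∀ k, 0 < r.τ k) {c : ℝ} (hc : 0 < c)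
    (h : ∀ k, c ≤ r.γ k * r.τ k ^ 2) :
    ∃ a : ℝ, 0 < a ∧ ∀ K : ℕ, 1 ≤ K → a * (K : ℝ) ^ 2 ≤ r.T K := by
  have hσ0 : 0 < r.σ 0 := mul_pos hγ0 (hτ 0)
  -- The factor 3 comes from (k+2)² − (k+1)² = 2k + 3 ≤ 3(k+1), the increment needed in the
  -- induction γ_k ≥ (a(k+1))².
  obtain ⟨a, ha0, ha1, ha2⟩ : ∃ a : ℝ, 0 < a ∧ a ≤ √(r.γ 0) ∧ 3 * a ≤ μ * √c :=
    ⟨min (√(r.γ 0)) (μ * √c / 3), lt_min (by positivity) (by positivity), min_le_left _ _, by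
      linarith [min_le_right (√(r.γ 0)) (μ * √c / 3)]⟩
  have hsc : √c ^ 2 = c := Real.sq_sqrt hc.le
  have hσ : ∀ k, (a * (k + 1)) ^ 2 ≤ r.γ k → √c * (a * (k + 1)) ≤ r.σ k := by
    intro k hk
    refine (sq_le_sq₀ (by positivity) (mul_pos (hγp k) (hτ k)).le).1 ?_
    have h1 := mul_le_mul (h k) hk (by positivity) (mul_nonneg (hγp k).le (sq_nonneg _))
    have h2 : (r.γ k * r.τ k) ^ 2 = r.γ k * r.τ k ^ 2 * r.γ k := by ring
    rw [mul_pow (√c), hsc, h2]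
    exact h1
  have hγk : ∀ k : ℕ, (a * (k + 1)) ^ 2 ≤ r.γ k := by
    intro k
    induction k with
    | zero =>
      have := mul_self_le_mul_self ha0.le ha1
      rw [Real.mul_self_sqrt hγ0.le] at this
      simpa [sq] using this
    | succ k ih =>
      have h1 := hσ k ih
      have h2 : r.γ (k + 1) = r.γ k + μ * r.σ k := by rw [hγ, σ]; ring
      have h3 := mul_le_mul_of_nonneg_left h1 hμ.le
      have h4 : 3 * a * (a * (k + 1)) ≤ μ * √c * (a * (k + 1)) :=
        mul_le_mul_of_nonneg_right ha2 (by positivity)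
      rw [h2]
      push_cast
      have : (0 : ℝ) ≤ k := Nat.cast_nonneg k
      nlinarith [mul_nonneg (mul_self_nonneg a) this, mul_self_nonneg a]
  refine ⟨√c * a / (2 * r.σ 0), by positivity, fun K _ => ?_⟩
  have h1 : √c * a * (K : ℝ) ^ 2 / 2 ≤ ∑ k ∈ Finset.range K, r.σ k := by
    clear * - hσ hγk hc ha0
    induction K with
    | zero => simp
    | succ k ih =>
      rw [Finset.sum_range_succ]
      have := hσ k (hγk k)
      have h0 : 0 ≤ √c * a := by positivity
      push_cast
      nlinarith
  rw [← σ_zero_mul_T hσ0.ne'] at h1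
  rw [div_mul_eq_mul_div, div_le_iff₀ (by positivity)]
  linarith

end Trace

end

/-! ### Candidates and acceptance of small trial steps -/

section

variable {n p m : ℕ} {P : Problem n p m} {φp : Euc n → ℝ} {φd : Dual p m → ℝ} {μ : ℝ}
  {c : Params} {v : Variant}

namespace Variant

theorem dualDomain_subset (v : Variant) (P : Problem n p m) : v.dualDomain P ⊆ P.Y := by
  cases v with
  | xy => exact subset_rfl
  | yx B => exact fun y hy => hy.1

theorem convex_dualDomain (v : Variant) (P : Problem n p m) : Convex ℝ (v.dualDomain P) := by
  cases v with
  | xy => exact P.convex_Y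
  | yx B =>
    have h : Metric.closedBall (0 : Dual p m) B = {y | ‖y‖ ≤ B} := by
      ext y
      simp
    have h2 := convex_closedBall (0 : Dual p m) B
    rw [h] at h2
    exact P.convex_Y.inter h2

theorem isClosed_dualDomain (v : Variant) (P : Problem n p m) : IsClosed (v.dualDomain P) := by
  cases v with
  | xy => exact P.isClosed_Y
  | yx B => exact P.isClosed_Y.inter (isClosed_le continuous_norm continuous_const)

end Variant

/-- The data of the next iteration, after accepting the step size `τ` and `(x', y')`. -/
def Iter.next (c : Params) (v : Variant) (I : Iter n p m) (τ γ' : ℝ) (x' : Euc n)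
    (y' : Dual p m) : Iter n p m where
  x := x'
  xPrev := I.x
  y := y'
  yPrev := I.y
  γ := γ'
  σPrev := I.γ * τ
  α := nextα c v τ (I.γ * τ)
  β := nextβ c v (I.γ * τ)

/-- The invariants of the data at the start of an iteration. -/
structure Iter.OK (P : Problem n p m) (c : Params) (v : Variant) (I : Iter n p m) : Prop where
  x_mem : I.x ∈ P.X
  y_mem : I.y ∈ v.dualDomain P
  γ_ge : c.γ₀ ≤ I.γ
  coeffs : match v with
    | .xy => I.σPrev * I.α ≤ I.γ * c.cα ∧ I.σPrev * I.β ≤ I.γ * c.cβ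
    | .yx _ => I.σPrev * I.α = c.cα

theorem IsCandidate.mem {I : Iter n p m} {τ : ℝ} {x' : Euc n} {y' : Dual p m}
    (h : IsCandidate P φp φd v I τ x' y') : x' ∈ P.X ∧ y' ∈ v.dualDomain P := by
  cases v with
  | xy => exact ⟨h.1.1, h.2.1⟩
  | yx B => exact ⟨h.2.1, h.1.1⟩

theorem exists_isCandidate (hs : P.SetsOK) (hφp : IsDistGen φp P.X) (hφd : IsDistGen φd P.Y)
    {I : Iter n p m} (hx : I.x ∈ P.X) (hy : I.y ∈ v.dualDomain P) (hγ : 0 < I.γ) {τ : ℝ}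
    (hτ : 0 < τ) : ∃ x' y', IsCandidate P φp φd v I τ x' y' := by
  have hpx : ∀ s, ∃ u', IsArgmin (fun u => ⟪s, u⟫_ℝ + 1 / τ * bregman φp u I.x) P.X u' := fun s =>
    exists_prox hφp hs.compact_X.isClosed hx s (one_div_pos.2 hτ)
  have hpy : ∀ s, ∃ u', IsArgmin (fun w => -⟪s, w⟫_ℝ + 1 / (I.γ * τ) * bregman φd w I.y)
      (v.dualDomain P) u' := fun s => by
    simp only [← inner_neg_left]
    exact exists_prox (hφd.mono (v.dualDomain_subset P)) (v.isClosed_dualDomain P) hy (-s)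
      (one_div_pos.2 (mul_pos hγ hτ))
  cases v with
  | xy =>
    obtain ⟨x', hx'⟩ := hpx _
    obtain ⟨y', hy'⟩ := hpy _
    exact ⟨x', y', hx', hy'⟩
  | yx B =>
    obtain ⟨y', hy'⟩ := hpy _
    obtain ⟨x', hx'⟩ := hpx _
    exact ⟨x', y', hy', hx'⟩

/-- The change of gradient due to y is charged to D_d/σ. The change due to x is charged to D_p/τ, of
which the momentum already uses the fraction cα + cβ. Both demands are smallness conditions on γτ².
-/
theorem accepts_xy (hφp : IsDistGen φp P.X) (hφd : IsDistGen φd P.Y) (hc : c.OK .xy)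
    {L : ℝ} (hL1 : ∀ x ∈ P.X, ∀ u ∈ P.X, ∀ y, ‖P.gradX u y - P.gradX x y‖ ≤ L * (1 + ‖y‖) * ‖u - x‖)
    (hL2 : ∀ x ∈ P.X, ∀ y w, ‖P.gradX x y - P.gradX x w‖ ≤ L * ‖y - w‖) {Q : ℝ}
    {I : Iter n p m} (hI : I.OK P c .xy) (hQ : L * (1 + ‖I.y‖) ≤ Q) {τ : ℝ} (hτ : 0 < τ)
    (hτ1 : I.γ * τ ^ 2 * L ^ 2 ≤ c.cα * (1 - c.δ))
    (hτ2 : I.γ * τ ^ 2 * Q ^ 2 ≤ c.γ₀ * c.cβ * (1 - c.cα - c.cβ - c.δ))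
    {x' : Euc n} {y' : Dual p m} (hx' : x' ∈ P.X) :
    Accepts P φp φd c .xy I τ x' y' := by
  have hγ : 0 < I.γ := hc.γ₀_pos.trans_le hI.γ_ge
  have hα := hc.cα_pos
  have hβ : 0 < c.cβ := hc.coeffs.1
  have hγ₀ := hc.γ₀_pos
  have hDp := hφp.le_bregman (u := x') hI.x_mem
  have hDd := hφd.le_bregman (u := y') hI.y_mem
  have hDp0 := hφp.bregman_nonneg (u := x') hI.x_mem
  have hDd0 := hφd.bregman_nonneg (u := y') hI.y_mem
  have hσ : 0 < I.γ * τ := mul_pos hγ hτ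
  have h1 : ‖P.gradX x' y' - P.gradX x' I.y‖ ^ 2 ≤ L ^ 2 * (2 * bregman φd y' I.y) := by
    have := pow_le_pow_left₀ (norm_nonneg _) (hL2 x' hx' y' I.y) 2
    rw [mul_pow] at this
    exact this.trans (mul_le_mul_of_nonneg_left (by linarith) (sq_nonneg _))
  have h2 : ‖P.gradX x' I.y - P.gradX I.x I.y‖ ^ 2 ≤ Q ^ 2 * (2 * bregman φp x' I.x) := by
    have h := (hL1 I.x hI.x_mem x' hx' I.y).trans (mul_le_mul_of_nonneg_right hQ (norm_nonneg _))
    have := pow_le_pow_left₀ (norm_nonneg _) h 2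
    rw [mul_pow] at this
    exact this.trans (mul_le_mul_of_nonneg_left (by linarith) (sq_nonneg _))
  have h3 : 1 / (2 * (c.cα / τ)) * ‖P.gradX x' y' - P.gradX x' I.y‖ ^ 2
      ≤ (1 - c.δ) / (I.γ * τ) * bregman φd y' I.y := by
    calc _ ≤ 1 / (2 * (c.cα / τ)) * (L ^ 2 * (2 * bregman φd y' I.y)) :=
          mul_le_mul_of_nonneg_left h1 (by positivity)
      _ = τ * L ^ 2 / c.cα * bregman φd y' I.y := by field_simp
      _ ≤ _ := by
        refine mul_le_mul_of_nonneg_right ?_ hDd0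
        rw [div_le_div_iff₀ hα hσ]
        linarith
  have h4 : 1 / (2 * (c.γ₀ * (c.cβ / (I.γ * τ)))) * ‖P.gradX x' I.y - P.gradX I.x I.y‖ ^ 2
      ≤ (1 - c.cα - c.cβ - c.δ) / τ * bregman φp x' I.x := by
    calc _ ≤ 1 / (2 * (c.γ₀ * (c.cβ / (I.γ * τ)))) * (Q ^ 2 * (2 * bregman φp x' I.x)) :=
          mul_le_mul_of_nonneg_left h2 (by positivity)
      _ = I.γ * τ * Q ^ 2 / (c.γ₀ * c.cβ) * bregman φp x' I.x := by field_simp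
      _ ≤ _ := by
        refine mul_le_mul_of_nonneg_right ?_ hDp0
        rw [div_le_div_iff₀ (by positivity) hτ]
        linarith
  have h5 : I.σPrev / (I.γ * τ) * (I.α + I.β) ≤ (c.cα + c.cβ) / τ := by
    rw [div_mul_eq_mul_div, div_le_div_iff₀ hσ hτ]
    have := hI.coeffs
    simp only at this
    nlinarith [mul_le_mul_of_nonneg_right this.1 hτ.le, mul_le_mul_of_nonneg_right this.2 hτ.le]
  have h6 := mul_le_mul_of_nonneg_right h5 hDp0
  simp only [Accepts, testFun, nextα, nextβ]
  have h7 : (1 - c.cα - c.cβ - c.δ) / τ * bregman φp x' I.x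
      = 1 / τ * bregman φp x' I.x - (c.cα + c.cβ) / τ * bregman φp x' I.x
        - c.δ / τ * bregman φp x' I.x := by ring
  have h8 : (1 - c.δ) / (I.γ * τ) * bregman φd y' I.y
      = 1 / (I.γ * τ) * bregman φd y' I.y - c.δ / (I.γ * τ) * bregman φd y' I.y := by ring
  rw [h7] at h4
  rw [h8] at h3
  linarith

/-- Convexity at `x'` bounds the error by the gradient difference paired with x' − x, so nothing is
integrated along the segment; the price is Q in place of Q/2. -/
theorem lagrangian_linearization_error_le (hf : P.FunctionsOK μ) {Q : ℝ} {x x' : Euc n}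
    {y : Dual p m} (hx : x ∈ P.X) (hx' : x' ∈ P.X) (hy : y ∈ P.Y)
    (hQ : ‖P.gradX x' y - P.gradX x y‖ ≤ Q * ‖x' - x‖) :
    P.Φ x' y - P.Φ x y - ⟪P.gradX x y, x' - x⟫_ℝ ≤ Q * ‖x' - x‖ ^ 2 := by
  have h1 := hf.gradX_inequality hx' hx hy
  have h2 : ⟪P.gradX x' y - P.gradX x y, x' - x⟫_ℝ ≤ Q * ‖x' - x‖ * ‖x' - x‖ :=
    (real_inner_le_norm _ _).trans (mul_le_mul_of_nonneg_right hQ (norm_nonneg _))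
  have h3 : ⟪P.gradX x' y, x - x'⟫_ℝ = -⟪P.gradX x' y, x' - x⟫_ℝ := by
    rw [← inner_neg_right, neg_sub]
  have h4 : 0 ≤ μ / 2 * ‖x - x'‖ ^ 2 := mul_nonneg (by linarith [hf.mu_nonneg]) (sq_nonneg _)
  rw [inner_sub_left] at h2
  nlinarith

/-- The room (1 − δ)/τ in front of D_p is split into halves, one for the linearization error and one
for the change of the residual; the dual terms only need cα + δ ≤ 1. -/
theorem accepts_yx (hf : P.FunctionsOK μ) (hφp : IsDistGen φp P.X) (hφd : IsDistGen φd P.Y)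
    {B : ℝ} (hc : c.OK (.yx B))
    {L Q : ℝ} (hL1 : ∀ x ∈ P.X, ∀ u ∈ P.X, ∀ y ∈ Variant.dualDomain (.yx B) P,
      ‖P.gradX u y - P.gradX x y‖ ≤ Q * ‖u - x‖)
    (hL3 : ∀ x ∈ P.X, ∀ u ∈ P.X, ‖P.res u - P.res x‖ ≤ L * ‖u - x‖)
    {I : Iter n p m} (hI : I.OK P c (.yx B)) {τ : ℝ} (hτ : 0 < τ)
    (hτ1 : 2 * Q * τ ≤ (1 - c.δ) / 2)
    (hτ2 : I.γ * τ ^ 2 * L ^ 2 ≤ c.cα * ((1 - c.δ) / 2))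
    {x' : Euc n} {y' : Dual p m} (hx' : x' ∈ P.X) (hy' : y' ∈ Variant.dualDomain (.yx B) P) :
    Accepts P φp φd c (.yx B) I τ x' y' := by
  have hγ : 0 < I.γ := hc.γ₀_pos.trans_le hI.γ_ge
  have hα := hc.cα_pos
  have hDp := hφp.le_bregman (u := x') hI.x_mem
  have hDp0 := hφp.bregman_nonneg (u := x') hI.x_mem
  have hDd0 := hφd.bregman_nonneg (u := y') (Variant.dualDomain_subset _ P hI.y_mem)
  have hσ : 0 < I.γ * τ := mul_pos hγ hτ
  have hQ : 0 ≤ Q * ‖x' - I.x‖ := (norm_nonneg _).trans (hL1 I.x hI.x_mem x' hx' y' hy')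
  have h1 : P.Φ x' y' - P.Φ I.x y' - ⟪P.gradX I.x y', x' - I.x⟫_ℝ
      ≤ (1 - c.δ) / 2 / τ * bregman φp x' I.x := by
    have h := lagrangian_linearization_error_le hf hI.x_mem hx'
      (Variant.dualDomain_subset _ P hy') (hL1 I.x hI.x_mem x' hx' y' hy')
    refine h.trans ?_
    rw [div_mul_eq_mul_div, le_div_iff₀ hτ]
    have h2 : Q * ‖x' - I.x‖ ^ 2 * τ = 2 * Q * τ * (1 / 2 * ‖x' - I.x‖ ^ 2) := by ring
    rw [h2]
    have h3 : 0 ≤ (1 - c.δ) / 2 := by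
      have := hc.coeffs.2.1
      linarith
    exact (mul_le_mul_of_nonneg_right hτ1 (by positivity)).trans
      (mul_le_mul_of_nonneg_left hDp h3)
  have h2 : ‖P.res x' - P.res I.x‖ ^ 2 ≤ L ^ 2 * (2 * bregman φp x' I.x) := by
    have := pow_le_pow_left₀ (norm_nonneg _) (hL3 I.x hI.x_mem x' hx') 2
    rw [mul_pow] at this
    exact this.trans (mul_le_mul_of_nonneg_left (by linarith) (sq_nonneg _))
  have h3 : 1 / (2 * (c.cα / (I.γ * τ))) * ‖P.res x' - P.res I.x‖ ^ 2
      ≤ (1 - c.δ) / 2 / τ * bregman φp x' I.x := by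
    calc _ ≤ 1 / (2 * (c.cα / (I.γ * τ))) * (L ^ 2 * (2 * bregman φp x' I.x)) :=
          mul_le_mul_of_nonneg_left h2 (by positivity)
      _ = I.γ * τ * L ^ 2 / c.cα * bregman φp x' I.x := by field_simp
      _ ≤ _ := by
        refine mul_le_mul_of_nonneg_right ?_ hDp0
        rw [div_le_div_iff₀ hα hτ]
        linarith
  have h4 : I.σPrev / (I.γ * τ) * I.α = c.cα / (I.γ * τ) := by
    rw [div_mul_eq_mul_div, hI.coeffs]
  have h5 : c.δ / (I.γ * τ) * bregman φd y' I.y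
      ≤ (1 / (I.γ * τ) - c.cα / (I.γ * τ)) * bregman φd y' I.y := by
    refine mul_le_mul_of_nonneg_right ?_ hDd0
    rw [← sub_div]
    refine div_le_div_of_nonneg_right ?_ hσ.le
    have := hc.coeffs.2.2
    linarith
  simp only [Accepts, testFun, nextα, P.gradY_eq, h4]
  have h7 : (1 - c.δ) / 2 / τ * bregman φp x' I.x
      = 1 / 2 * (1 / τ * bregman φp x' I.x - c.δ / τ * bregman φp x' I.x) := by ring
  rw [h7] at h1 h3
  linarith

/-- Trial step sizes `τ` with `γ_k τ²` small are accepted. -/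
theorem exists_accepts (hf : P.FunctionsOK μ) (hs : P.SetsOK) (hφp : IsDistGen φp P.X)
    (hφd : IsDistGen φd P.Y) (hc : c.OK v) (R : ℝ) :
    ∃ s : ℝ, 0 < s ∧ ∀ I : Iter n p m, I.OK P c v → ‖I.y‖ ≤ R → ∀ τ : ℝ, 0 < τ →
      I.γ * τ ^ 2 ≤ s → ∀ x' ∈ P.X, ∀ y' ∈ v.dualDomain P, Accepts P φp φd c v I τ x' y' := by
  obtain ⟨L, hL, hL1, hL2, hL3⟩ := hf.exists_lipschitz hs
  have hα := hc.cα_pos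
  have hγ₀ := hc.γ₀_pos
  cases v with
  | xy =>
    have hβ : 0 < c.cβ := hc.coeffs.1
    have hsum : c.cα + c.cβ + c.δ < 1 := hc.coeffs.2
    have hδ : 0 < 1 - c.δ := by linarith
    have hδ' : 0 < 1 - c.cα - c.cβ - c.δ := by linarith
    set Q := L * (1 + |R|) with hQ
    have hQ0 : 0 < Q := by positivity
    refine ⟨min (c.cα * (1 - c.δ) / L ^ 2) (c.γ₀ * c.cβ * (1 - c.cα - c.cβ - c.δ) / Q ^ 2),
      lt_min (by positivity) (by positivity), fun I hI hy τ hτ hs x' hx' y' _ => ?_⟩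
    refine accepts_xy hφp hφd hc hL1 hL2 (Q := Q) hI ?_ hτ ?_ ?_ hx'
    · exact mul_le_mul_of_nonneg_left (by linarith [le_abs_self R]) hL.le
    · exact (le_div_iff₀ (by positivity)).1 (hs.trans (min_le_left _ _))
    · exact (le_div_iff₀ (by positivity)).1 (hs.trans (min_le_right _ _))
  | yx B =>
    have hδ : 0 < 1 - c.δ := by linarith [hc.coeffs.2.1]
    set Q := L * (1 + |B|) with hQ
    have hQ0 : 0 < Q := by positivity
    refine ⟨min (c.cα * ((1 - c.δ) / 2) / L ^ 2) (c.γ₀ * ((1 - c.δ) / 2 / (2 * Q)) ^ 2),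
      lt_min (by positivity) (by positivity), fun I hI hy τ hτ hs x' hx' y' hy' => ?_⟩
    refine accepts_yx hf hφp hφd hc (Q := Q) (fun x hx u hu y hy => ?_) hL3 hI hτ ?_ ?_ hx' hy'
    · refine (hL1 x hx u hu y).trans (mul_le_mul_of_nonneg_right ?_ (norm_nonneg _))
      exact mul_le_mul_of_nonneg_left (by linarith [hy.2, le_abs_self B]) hL.le
    -- The linearization demand restricts τ alone; γ ≥ γ₀ derives it from the bound on γτ².
    · have h1 : c.γ₀ * τ ^ 2 ≤ c.γ₀ * ((1 - c.δ) / 2 / (2 * Q)) ^ 2 :=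
        (mul_le_mul_of_nonneg_right hI.γ_ge (sq_nonneg _)).trans (hs.trans (min_le_right _ _))
      have h2 := (sq_le_sq₀ hτ.le (by positivity)).1 (le_of_mul_le_mul_left h1 hγ₀)
      rw [le_div_iff₀ (by positivity)] at h2
      linarith
    · exact (le_div_iff₀ (by positivity)).1 (hs.trans (min_le_left _ _))

end

section

variable {n p m : ℕ} {P : Problem n p m} {φp : Euc n → ℝ} {φd : Dual p m → ℝ} {μ : ℝ}
  {c : Params} {v : Variant} {x₀ : Euc n} {y₀ : Dual p m}

/-! ### Existence of a run -/

/-- The full state of the algorithm at the start of an iteration. -/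
structure SearchState (n p m : ℕ) extends Iter n p m where
  τPrev : ℝ
  τInit : ℝ

/-- The state after accepting the step size `τ` and the candidate `(x', y')`. -/
def SearchState.next (μ : ℝ) (c : Params) (v : Variant) (s : SearchState n p m) (τ : ℝ)
    (x' : Euc n) (y' : Dual p m) : SearchState n p m where
  toIter := s.toIter.next c v τ (s.γ * (1 + μ * τ)) x' y'
  τPrev := τ
  τInit := τ * √(s.γ / (s.γ * (1 + μ * τ)) * (1 + c.cnm * (τ / s.τPrev)))

/-- The invariant of the states. -/
structure SearchState.OK (P : Problem n p m) (c : Params) (v : Variant) (s : SearchState n p m) :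
    Prop where
  iter : s.toIter.OK P c v
  τPrev_pos : 0 < s.τPrev
  τInit_pos : 0 < s.τInit

theorem SearchState.OK.next {s : SearchState n p m} (h : s.OK P c v) (hμ : 0 ≤ μ) (hc : c.OK v)
    {τ : ℝ} (hτ : 0 < τ) {x' : Euc n} {y' : Dual p m} (hx' : x' ∈ P.X)
    (hy' : y' ∈ v.dualDomain P) : (s.next μ c v τ x' y').OK P c v := by
  have hγ : 0 < s.γ := hc.γ₀_pos.trans_le h.iter.γ_ge
  have h1 : 0 ≤ μ * τ := mul_nonneg hμ hτ.le
  have hcnm : 0 ≤ c.cnm := by rcases hc.cnm_mem with h | h <;> simp [h]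
  have hα := hc.cα_pos
  refine ⟨⟨hx', hy', ?_, ?_⟩, hτ, ?_⟩
  · have := h.iter.γ_ge
    simp only [SearchState.next, Iter.next]
    nlinarith
  · cases v with
    | xy =>
      have hβ : 0 < c.cβ := hc.coeffs.1
      simp only [SearchState.next, Iter.next, nextα, nextβ]
      constructor
      · have : s.γ * τ * (c.cα / τ) = s.γ * c.cα := by field_simp
        rw [this]
        nlinarith [mul_nonneg (mul_nonneg hγ.le h1) hα.le]
      · have h2 : s.γ * τ * (c.γ₀ * (c.cβ / (s.γ * τ))) = c.γ₀ * c.cβ := by field_simp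
        rw [h2]
        refine mul_le_mul_of_nonneg_right ?_ hβ.le
        have := h.iter.γ_ge
        nlinarith
    | yx B =>
      simp only [SearchState.next, Iter.next, nextα]
      field_simp
  · simp only [SearchState.next]
    have := h.τPrev_pos
    positivity

/-- The trial values satisfy γ(η^j τInit)² → 0, so some candidate is accepted. Minimality of j means
that every candidate at an earlier trial is rejected, so uniqueness of the argmins is not needed. -/
theorem SearchState.OK.exists_step (hf : P.FunctionsOK μ) (hs : P.SetsOK)
    (hφp : IsDistGen φp P.X) (hφd : IsDistGen φd P.Y) (hc : c.OK v) {s : SearchState n p m}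
    (h : s.OK P c v) : ∃ (τ : ℝ) (x' : Euc n) (y' : Dual p m), 0 < τ ∧
      (∃ j : ℕ, τ = c.η ^ j * s.τInit ∧
        ∀ i < j, ∀ x' y', IsCandidate P φp φd v s.toIter (c.η ^ i * s.τInit) x' y' →
          ¬ Accepts P φp φd c v s.toIter (c.η ^ i * s.τInit) x' y') ∧
      IsCandidate P φp φd v s.toIter τ x' y' ∧ Accepts P φp φd c v s.toIter τ x' y' := by
  classical
  have hγ : 0 < s.γ := hc.γ₀_pos.trans_le h.iter.γ_ge
  have hη := hc.η_pos
  have hτ := h.τInit_pos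
  obtain ⟨S, hS, hacc⟩ := exists_accepts hf hs hφp hφd hc ‖s.y‖
  have hex : ∃ j : ℕ, ∃ x' y', IsCandidate P φp φd v s.toIter (c.η ^ j * s.τInit) x' y' ∧
      Accepts P φp φd c v s.toIter (c.η ^ j * s.τInit) x' y' := by
    have hlim : Filter.Tendsto (fun j : ℕ => s.γ * (c.η ^ j * s.τInit) ^ 2) Filter.atTop
        (nhds (s.γ * (0 * s.τInit) ^ 2)) :=
      (((tendsto_pow_atTop_nhds_zero_of_lt_one hη.le hc.η_lt_one).mul_const _).pow 2).const_mul _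
    obtain ⟨j, hj⟩ := (hlim.eventually (gt_mem_nhds (by simpa using hS))).exists
    obtain ⟨x', y', hcand⟩ := exists_isCandidate hs hφp hφd h.iter.x_mem h.iter.y_mem hγ
      (mul_pos (pow_pos hη j) hτ)
    exact ⟨j, x', y', hcand, hacc _ h.iter le_rfl _ (mul_pos (pow_pos hη j) hτ) hj.le _
      hcand.mem.1 _ hcand.mem.2⟩
  obtain ⟨x', y', h1, h2⟩ := Nat.find_spec hex
  exact ⟨_, x', y', mul_pos (pow_pos hη _) hτ, ⟨Nat.find hex, rfl, fun i hi u w hu hw =>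
    Nat.find_min hex hi ⟨u, w, hu, hw⟩⟩, h1, h2⟩

theorem exists_isRun (hf : P.FunctionsOK μ) (hs : P.SetsOK)
    (hφp : IsDistGen φp P.X) (hφd : IsDistGen φd P.Y) (hc : c.OK v) (hx₀ : x₀ ∈ P.X)
    (hy₀ : y₀ ∈ v.dualDomain P) : ∃ r : Trace n p m, IsRun P φp φd μ c v x₀ y₀ r := by
  -- Choice is made at once for all states satisfying the invariant; iterating it gives the run.
  choose τ x' y' hτ hback hcand hacc using
    fun s : {s : SearchState n p m // s.OK P c v} =>
      s.2.exists_step hf hs hφp hφd hc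
  let s₀ : SearchState n p m :=
    { x := x₀, xPrev := x₀, y := y₀, yPrev := y₀, γ := c.γ₀, σPrev := c.γ₀ * c.τbar,
      α := nextα c v c.τbar (c.γ₀ * c.τbar), β := nextβ c v (c.γ₀ * c.τbar),
      τPrev := c.τbar, τInit := c.τbar }
  have hτbar := hc.τbar_pos
  have hγ₀ := hc.γ₀_pos
  have hs₀ : s₀.OK P c v := by
    refine ⟨⟨hx₀, hy₀, le_rfl, ?_⟩, hτbar, hτbar⟩
    cases v with
    | xy =>
      simp only [s₀, nextα, nextβ]
      constructor <;> exact le_of_eq (by field_simp)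
    | yx B =>
      simp only [s₀, nextα]
      field_simp
  let S : ℕ → {s : SearchState n p m // s.OK P c v} := fun k =>
    Nat.rec ⟨s₀, hs₀⟩ (fun _ s => ⟨s.1.next μ c v (τ s) (x' s) (y' s),
      s.2.next hf.mu_nonneg hc (hτ s) (hcand s).mem.1 (hcand s).mem.2⟩) k
  let r : Trace n p m :=
    { x := fun k => (S k).1.x, y := fun k => (S k).1.y, τ := fun k => τ (S k),
      γ := fun k => (S k).1.γ }
  have hiter : ∀ k, r.iter c v k = (S k).1.toIter := by
    intro k
    cases k <;> rfl
  have hinit : ∀ k, r.τInit c k = (S k).1.τInit := by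
    intro k
    -- The first trial step looks two steps back, so the cases 0 and 1 reach the initial values
    -- separately.
    rcases k with - | - | k <;> rfl
  refine ⟨r, rfl, rfl, rfl, fun k => rfl, fun k => ?_, fun k => ?_, fun k => ?_⟩
  · rw [hiter, hinit]
    exact hback (S k)
  · rw [hiter]
    exact hcand (S k)
  · rw [hiter]
    exact hacc (S k)

/-! ### Elementary properties of runs -/

namespace IsRun

variable {r : Trace n p m}

theorem pos_aux (h : IsRun P φp φd μ c v x₀ y₀ r) (hc : c.OK v) (hμ : 0 ≤ μ) (k : ℕ) :
    0 < r.γ k ∧ 0 < r.τPrev c k ∧ 0 < r.τInit c k := by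
  have hcnm : 0 ≤ c.cnm := by rcases hc.cnm_mem with h | h <;> simp [h]
  induction k with
  | zero => exact ⟨h.γ_zero ▸ hc.γ₀_pos, hc.τbar_pos, hc.τbar_pos⟩
  | succ k ih =>
    obtain ⟨h1, h2, h3⟩ := ih
    obtain ⟨j, hj, -⟩ := h.backtrack k
    have hτ : 0 < r.τ k := by
      rw [hj]
      exact mul_pos (pow_pos hc.η_pos _) h3
    have hγ : 0 < r.γ (k + 1) := by
      rw [h.γ_succ]
      positivity
    refine ⟨hγ, hτ, ?_⟩
    rw [Trace.τInit]
    positivity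

theorem γ_pos (h : IsRun P φp φd μ c v x₀ y₀ r) (hc : c.OK v) (hμ : 0 ≤ μ) (k : ℕ) :
    0 < r.γ k := (h.pos_aux hc hμ k).1

theorem τ_pos (h : IsRun P φp φd μ c v x₀ y₀ r) (hc : c.OK v) (hμ : 0 ≤ μ) (k : ℕ) :
    0 < r.τ k := (h.pos_aux hc hμ (k + 1)).2.1

theorem τPrev_pos (h : IsRun P φp φd μ c v x₀ y₀ r) (hc : c.OK v) (hμ : 0 ≤ μ) (k : ℕ) :
    0 < r.τPrev c k := (h.pos_aux hc hμ k).2.1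

theorem σ_pos (h : IsRun P φp φd μ c v x₀ y₀ r) (hc : c.OK v) (hμ : 0 ≤ μ) (k : ℕ) :
    0 < r.σ k := mul_pos (h.γ_pos hc hμ k) (h.τ_pos hc hμ k)

theorem σPrev_pos (h : IsRun P φp φd μ c v x₀ y₀ r) (hc : c.OK v) (hμ : 0 ≤ μ) (k : ℕ) :
    0 < r.σPrev c k := by
  cases k with
  | zero => exact mul_pos hc.γ₀_pos hc.τbar_pos
  | succ k => exact h.σ_pos hc hμ k

theorem γ_le_succ (h : IsRun P φp φd μ c v x₀ y₀ r) (hc : c.OK v) (hμ : 0 ≤ μ) (k : ℕ) :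
    r.γ k ≤ r.γ (k + 1) := by
  rw [h.γ_succ]
  nlinarith [mul_nonneg (h.γ_pos hc hμ k).le (mul_nonneg hμ (h.τ_pos hc hμ k).le)]

theorem γ₀_le (h : IsRun P φp φd μ c v x₀ y₀ r) (hc : c.OK v) (hμ : 0 ≤ μ) (k : ℕ) :
    c.γ₀ ≤ r.γ k := by
  induction k with
  | zero => exact h.γ_zero.ge
  | succ k ih => exact ih.trans (h.γ_le_succ hc hμ k)

theorem σPrev_le (h : IsRun P φp φd μ c v x₀ y₀ r) (hc : c.OK v) (hμ : 0 ≤ μ) (k : ℕ) :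
    r.σPrev c k ≤ r.γ k * r.τPrev c k := by
  cases k with
  | zero => exact (congrArg (· * c.τbar) h.γ_zero).ge
  | succ k => exact mul_le_mul_of_nonneg_right (h.γ_le_succ hc hμ k) (h.τ_pos hc hμ k).le

theorem x_mem (h : IsRun P φp φd μ c v x₀ y₀ r) (hx₀ : x₀ ∈ P.X) (k : ℕ) : r.x k ∈ P.X := by
  cases k with
  | zero => exact h.x_zero ▸ hx₀
  | succ k => exact (h.candidate k).mem.1

theorem y_mem (h : IsRun P φp φd μ c v x₀ y₀ r) (hy₀ : y₀ ∈ v.dualDomain P) (k : ℕ) :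
    r.y k ∈ v.dualDomain P := by
  cases k with
  | zero => exact h.y_zero ▸ hy₀
  | succ k => exact (h.candidate k).mem.2

theorem iter_ok (h : IsRun P φp φd μ c v x₀ y₀ r) (hc : c.OK v) (hμ : 0 ≤ μ) (hx₀ : x₀ ∈ P.X)
    (hy₀ : y₀ ∈ v.dualDomain P) (k : ℕ) : (r.iter c v k).OK P c v := by
  refine ⟨h.x_mem hx₀ k, h.y_mem hy₀ k, h.γ₀_le hc hμ k, ?_⟩
  have hσ := h.σPrev_pos hc hμ k
  have hτ := h.τPrev_pos hc hμ k
  cases v with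
  | xy =>
    have hβ : 0 < c.cβ := hc.coeffs.1
    simp only [Trace.iter, nextα, nextβ]
    constructor
    · rw [← mul_div_assoc, div_le_iff₀ hτ]
      nlinarith [mul_le_mul_of_nonneg_right (h.σPrev_le hc hμ k) hc.cα_pos.le]
    · have h2 : r.σPrev c k * (c.γ₀ * (c.cβ / r.σPrev c k)) = c.γ₀ * c.cβ := by field_simp
      rw [h2]
      exact mul_le_mul_of_nonneg_right (h.γ₀_le hc hμ k) hβ.le
  | yx B =>
    simp only [Trace.iter, nextα]
    field_simp

/-- If the dual iterates are bounded, then `γ_k τ_k²` is bounded away from zero. -/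
theorem exists_step_lower_bound (h : IsRun P φp φd μ c v x₀ y₀ r) (hf : P.FunctionsOK μ)
    (hs : P.SetsOK) (hφp : IsDistGen φp P.X) (hφd : IsDistGen φd P.Y) (hc : c.OK v)
    (hx₀ : x₀ ∈ P.X) (hy₀ : y₀ ∈ v.dualDomain P) {R : ℝ} (hR : ∀ k, ‖r.y k‖ ≤ R) :
    ∃ s : ℝ, 0 < s ∧ ∀ k, s ≤ r.γ k * r.τ k ^ 2 := by
  obtain ⟨S, hS, hacc⟩ := exists_accepts hf hs hφp hφd hc R
  have hμ := hf.mu_nonneg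
  have hη := hc.η_pos
  have hcnm : 0 ≤ c.cnm := by rcases hc.cnm_mem with h | h <;> simp [h]
  -- Either the first trial is accepted, or the trial just before the accepted one was rejected. In
  -- the latter case its γτ² exceeded `S`, and one reduction costs only the factor η².
  have hstep : ∀ k, min (r.γ k * r.τInit c k ^ 2) (c.η ^ 2 * S) ≤ r.γ k * r.τ k ^ 2 := by
    intro k
    obtain ⟨j, hj, hrej⟩ := h.backtrack k
    rcases j with - | j
    · rw [pow_zero, one_mul] at hj
      rw [hj]
      exact min_le_left _ _
    · refine (min_le_right _ _).trans ?_
      have hτ : 0 < c.η ^ j * r.τInit c k := mul_pos (pow_pos hη _) (h.pos_aux hc hμ k).2.2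
      have hok := h.iter_ok hc hμ hx₀ hy₀ k
      obtain ⟨x', y', hcand⟩ := exists_isCandidate (φp := φp) (φd := φd) hs hφp hφd hok.x_mem
        hok.y_mem (h.γ_pos hc hμ k : 0 < (r.iter c v k).γ) hτ
      by_contra! hlt
      refine hrej j (Nat.lt_succ_self j) x' y' hcand
        (hacc _ hok (hR k) _ hτ ?_ _ hcand.mem.1 _ hcand.mem.2)
      have h1 : r.γ k * r.τ k ^ 2 = c.η ^ 2 * (r.γ k * (c.η ^ j * r.τInit c k) ^ 2) := by
        rw [hj]
        ring
      rw [h1] at hlt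
      exact (lt_of_mul_lt_mul_left hlt (by positivity)).le
  refine ⟨min (c.γ₀ * c.τbar ^ 2) (c.η ^ 2 * S),
    lt_min (mul_pos hc.γ₀_pos (pow_pos hc.τbar_pos 2)) (by positivity), fun k => ?_⟩
  induction k with
  | zero =>
    have := hstep 0
    rwa [h.γ_zero] at this ⊢
  | succ k ih =>
    refine le_trans (le_min (ih.trans ?_) (min_le_right _ _)) (hstep (k + 1))
    have hγ := h.γ_pos hc hμ k
    have hγ' := h.γ_pos hc hμ (k + 1)
    have hτ := h.τ_pos hc hμ k
    have hτ' := h.τPrev_pos hc hμ k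
    -- The first trial is scaled so that γ_{k+1} τ² starts at γ_k τ_k² times a factor at least 1;
    -- the non-monotone switch only enlarges it.
    rw [Trace.τInit, mul_pow, Real.sq_sqrt (by positivity)]
    have h1 : r.γ (k + 1) * (r.τ k ^ 2 * (r.γ k / r.γ (k + 1) * (1 + c.cnm * (r.τ k / r.τPrev c k))))
        = r.γ k * r.τ k ^ 2 * (1 + c.cnm * (r.τ k / r.τPrev c k)) := by field_simp
    rw [h1]
    exact le_mul_of_one_le_right (by positivity) (by simp; positivity)

end IsRun

end

/-! ### Energy estimate for the xy variant -/

section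

section

variable {E : Type*} [NormedAddCommGroup E] [InnerProductSpace ℝ E]

theorem inner_le_young (a b : E) {α d : ℝ} (hα : 0 < α) (hd : 1 / 2 * ‖b‖ ^ 2 ≤ d) :
    ⟪a, b⟫_ℝ ≤ 1 / (2 * α) * ‖a‖ ^ 2 + α * d := by
  have h1 := real_inner_le_norm a b
  have h2 : 0 ≤ (‖a‖ - α * ‖b‖) ^ 2 / (2 * α) := by positivity
  have h3 : (‖a‖ - α * ‖b‖) ^ 2 / (2 * α)
      = 1 / (2 * α) * ‖a‖ ^ 2 + α * (1 / 2 * ‖b‖ ^ 2) - ‖a‖ * ‖b‖ := by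
    field_simp
    ring
  have h4 := mul_le_mul_of_nonneg_left hd hα.le
  linarith

/-- First-order optimality combined with the three-point identity; this is the source of the
telescoping distances. -/
theorem IsArgmin.prox_three_point [CompleteSpace E] {φ : E → ℝ} {S : Set E} {s u' w : E} {τ : ℝ}
    (hτ : 0 < τ) (h : IsDistGen φ S) (hS : Convex ℝ S)
    (hmin : IsArgmin (fun u => ⟪s, u⟫_ℝ + 1 / τ * bregman φ u w) S u') {u : E} (hu : u ∈ S) :
    τ * ⟪s, u' - u⟫_ℝ ≤ bregman φ u w - bregman φ u u' - bregman φ u' w := by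
  have h1 := hmin.prox_variational h hS hu
  rw [inner_add_left, inner_smul_left, bregman_three_point] at h1
  have h2 : ⟪s, u' - u⟫_ℝ = -⟪s, u - u'⟫_ℝ := by rw [← inner_neg_right, neg_sub]
  rw [h2]
  simp only [conj_trivial] at h1
  have h3 := mul_le_mul_of_nonneg_left h1 hτ.le
  rw [mul_zero, mul_add, ← mul_assoc, mul_one_div_cancel hτ.ne', one_mul] at h3
  linarith

end

variable {n p m : ℕ} {P : Problem n p m} {φp : Euc n → ℝ} {φd : Dual p m → ℝ} {μ : ℝ}
  {c : Params} {v : Variant} {x₀ : Euc n} {y₀ : Dual p m} {r : Trace n p m}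

/-- The update of γ is designed for this: when μ > 0 the distance is Euclidean, so the extra weight
μσ_k D_p is the strong convexity term itself. -/
theorem IsRun.γ_succ_mul_bregman (h : IsRun P φp φd μ c v x₀ y₀ r) (hμ : 0 ≤ μ)
    (hφp_euclid : 0 < μ → ∀ x, φp x = 1 / 2 * ‖x‖ ^ 2) (k : ℕ) (x u : Euc n) :
    r.γ (k + 1) * bregman φp x u = r.γ k * bregman φp x u + r.σ k * (μ / 2 * ‖x - u‖ ^ 2) := by
  rw [h.γ_succ, Trace.σ]
  rcases hμ.eq_or_lt with h0 | h0
  · rw [← h0]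
    ring
  · rw [bregman_half_norm_sq (hφp_euclid h0)]
    ring

/-- The energy of the `xy` variant relative to the reference point `(x, y)`. -/
def xyEnergy (P : Problem n p m) (φp : Euc n → ℝ) (φd : Dual p m → ℝ) (I : Iter n p m)
    (x : Euc n) (y : Dual p m) : ℝ :=
  I.γ * bregman φp x I.x + bregman φd y I.y
    - I.σPrev * ⟪P.gradX I.x I.y - P.gradX I.xPrev I.yPrev, I.x - x⟫_ℝ
    + I.σPrev * (1 / (2 * I.α) * ‖P.gradX I.x I.y - P.gradX I.x I.yPrev‖ ^ 2
      + 1 / (2 * I.β) * ‖P.gradX I.x I.yPrev - P.gradX I.xPrev I.yPrev‖ ^ 2)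

/-- The gradient difference is split at (x^k, y^{k−1}) into a change in y, weighted by α, and a
change in x, weighted by β. -/
theorem inner_diff_le_young (P : Problem n p m) {I : Iter n p m}
    (hα : 0 < I.α) (hβ : 0 < I.β) {u : Euc n} {d : ℝ} (hd : 1 / 2 * ‖u‖ ^ 2 ≤ d) :
    ⟪P.gradX I.x I.y - P.gradX I.xPrev I.yPrev, u⟫_ℝ
      ≤ (1 / (2 * I.α) * ‖P.gradX I.x I.y - P.gradX I.x I.yPrev‖ ^ 2
        + 1 / (2 * I.β) * ‖P.gradX I.x I.yPrev - P.gradX I.xPrev I.yPrev‖ ^ 2)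
        + (I.α + I.β) * d := by
  have h1 := inner_le_young (P.gradX I.x I.y - P.gradX I.x I.yPrev) u hα hd
  have h2 := inner_le_young (P.gradX I.x I.yPrev - P.gradX I.xPrev I.yPrev) u hβ hd
  have h3 : P.gradX I.x I.y - P.gradX I.xPrev I.yPrev = (P.gradX I.x I.y - P.gradX I.x I.yPrev)
      + (P.gradX I.x I.yPrev - P.gradX I.xPrev I.yPrev) := by abel
  rw [h3, inner_add_left]
  linarith

theorem xyEnergy_next (hf : P.FunctionsOK μ)
    (hs : P.SetsOK) (hφp : IsDistGen φp P.X) (hφd : IsDistGen φd P.Y) (hδ : 0 ≤ c.δ)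
    {I : Iter n p m} (hxk : I.x ∈ P.X) (hyk : I.y ∈ P.Y) (hγ : 0 < I.γ) (hσP : 0 ≤ I.σPrev)
    (hα : 0 < I.α) (hβ : 0 < I.β) {τ γ' : ℝ} (hτ : 0 < τ) {x' : Euc n} {y' : Dual p m}
    (hcand : IsCandidate P φp φd .xy I τ x' y') (hacc : Accepts P φp φd c .xy I τ x' y')
    {x : Euc n} {y : Dual p m} (hx : x ∈ P.X) (hy : y ∈ P.Y)
    (hγs : γ' * bregman φp x x' = I.γ * bregman φp x x' + I.γ * τ * (μ / 2 * ‖x - x'‖ ^ 2)) :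
    I.γ * τ * (P.Φ x' y - P.Φ x y') + xyEnergy P φp φd (I.next c .xy τ γ' x' y') x y
      ≤ xyEnergy P φp φd I x y := by
  have hσ : 0 < I.γ * τ := mul_pos hγ hτ
  have hxk' : x' ∈ P.X := hcand.mem.1
  have hyk' : y' ∈ P.Y := hcand.mem.2
  have hDp0 := hφp.bregman_nonneg (u := x') hxk
  have hDd0 := hφd.bregman_nonneg (u := y') hyk
  have hx3 := hcand.1.prox_three_point hτ hφp hs.convex_X hx
  have hy3 := IsArgmin.prox_three_point (s := -P.gradY x' I.y) (w := I.y) hσ hφd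
    P.convex_Y (by simpa only [inner_neg_left] using! hcand.2) hy
  have hgrad := hf.gradX_inequality hxk' hx hyk'
  have hlin := P.Φ_sub_right x' y y'
  have hyoung := inner_diff_le_young P hα hβ
    (u := I.x - x') (d := bregman φp x' I.x)
    (by rw [norm_sub_rev]; exact hφp.le_bregman hxk)
  rw [P.gradY_eq] at hy3
  simp only [Accepts, testFun] at hacc
  simp only [xyEnergy, Iter.next]
  have hσθ : I.γ * τ * (I.σPrev / (I.γ * τ)) = I.σPrev := mul_div_cancel₀ _ hσ.ne'
  set θ := I.σPrev / (I.γ * τ)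
  set g := P.gradX I.x I.y
  set gP := P.gradX I.xPrev I.yPrev
  -- Because σθ = σ_{k−1}, the momentum contributes the cross term of the old energy minus a
  -- remainder against x^k − x^{k+1}; Young's inequality is applied to the latter.
  have e1 : I.γ * τ * ⟪(1 + θ) • g - θ • gP, x' - x⟫_ℝ = I.γ * τ * ⟪g, x' - x⟫_ℝ
      + I.σPrev * (⟪g - gP, I.x - x⟫_ℝ - ⟪g - gP, I.x - x'⟫_ℝ) := by
    have : (I.x - x) - (I.x - x') = x' - x := by abel
    rw [← inner_sub_right, this, ← hσθ]
    simp only [inner_sub_left, inner_smul_left, conj_trivial]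
    ring
  have e2 : ⟪P.gradX x' y', x - x'⟫_ℝ = -⟪P.gradX x' y' - g, x' - x⟫_ℝ - ⟪g, x' - x⟫_ℝ := by
    rw [← neg_sub x' x, inner_neg_right, inner_sub_left]
    ring
  have e3 : ⟪-P.res x', y' - y⟫_ℝ = ⟪y - y', P.res x'⟫_ℝ := by
    rw [← neg_sub y y', inner_neg_neg, real_inner_comm]
  rw [e2] at hgrad
  rw [e3] at hy3
  have hx3' := mul_le_mul_of_nonneg_left hx3 hγ.le
  rw [← mul_assoc, e1] at hx3'
  have hgrad' := mul_le_mul_of_nonneg_left hgrad hσ.le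
  have hyoung' := mul_le_mul_of_nonneg_left hyoung hσP
  have hacc' := mul_le_mul_of_nonneg_left hacc hσ.le
  have e4 : I.γ * τ * (-(c.δ / τ) * bregman φp x' I.x - c.δ / (I.γ * τ) * bregman φd y' I.y)
      = -(I.γ * (c.δ * bregman φp x' I.x)) - c.δ * bregman φd y' I.y := by
    field_simp
  have e5 : I.γ * τ * ((1 / τ - θ * (I.α + I.β)) * bregman φp x' I.x)
      = (I.γ - I.σPrev * (I.α + I.β)) * bregman φp x' I.x := by
    rw [← hσθ]
    field_simp
  have e6 : I.γ * τ * (1 / (I.γ * τ) * bregman φd y' I.y) = bregman φd y' I.y := by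
    field_simp
  have e7 : 0 ≤ I.γ * (c.δ * bregman φp x' I.x) := by positivity
  have e8 : 0 ≤ c.δ * bregman φd y' I.y := by positivity
  rw [e4, mul_sub, mul_add, mul_sub, e5, e6] at hacc'
  linear_combination hx3' + hy3 + hgrad' + hyoung' + hacc' + hγs + (I.γ * τ) * hlin + e7 + e8

namespace IsRun

theorem iter_α_pos (h : IsRun P φp φd μ c v x₀ y₀ r) (hc : c.OK v) (hμ : 0 ≤ μ) (k : ℕ) :
    0 < (r.iter c v k).α := by
  have h1 := h.σPrev_pos hc hμ k
  have h2 := h.τPrev_pos hc hμ k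
  have h3 := hc.cα_pos
  cases v <;> simp only [Trace.iter, nextα] <;> positivity

theorem iter_β_pos (h : IsRun P φp φd μ c .xy x₀ y₀ r) (hc : c.OK .xy) (hμ : 0 ≤ μ) (k : ℕ) :
    0 < (r.iter c .xy k).β := by
  have h1 := h.σPrev_pos hc hμ k
  have h3 := hc.γ₀_pos
  have h4 : 0 < c.cβ := hc.coeffs.1
  simp only [Trace.iter, nextβ]
  positivity

/-- By the same Young estimate the cross term costs at most (cα + cβ)γ_k D_p, less than the primal
part of the energy, so the dual distance survives. -/
theorem xyEnergy_ge (h : IsRun P φp φd μ c .xy x₀ y₀ r) (hf : P.FunctionsOK μ)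
    (hφp : IsDistGen φp P.X) (hc : c.OK .xy)
    (hx₀ : x₀ ∈ P.X) (hy₀ : y₀ ∈ P.Y) (k : ℕ) (x : Euc n) (y : Dual p m) :
    bregman φd y (r.y k) ≤ xyEnergy P φp φd (r.iter c .xy k) x y := by
  have hμ := hf.mu_nonneg
  have hγ := h.γ_pos hc hμ k
  have hσP := h.σPrev_pos hc hμ k
  have hxk := h.x_mem hx₀ k
  have hok := (h.iter_ok hc hμ hx₀ hy₀ k).coeffs
  have hD0 := hφp.bregman_nonneg (u := x) hxk
  have hyoung := inner_diff_le_young P (h.iter_α_pos hc hμ k) (h.iter_β_pos hc hμ k)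
    (u := r.x k - x) (d := bregman φp x (r.x k))
    (by rw [norm_sub_rev]; exact hφp.le_bregman hxk)
  have hyoung' := mul_le_mul_of_nonneg_left hyoung hσP.le
  have hsum : c.cα + c.cβ + c.δ < 1 := hc.coeffs.2
  have h1 := mul_le_mul_of_nonneg_right (add_le_add hok.1 hok.2) hD0
  have h2 : 0 ≤ r.γ k * (1 - c.cα - c.cβ) * bregman φp x (r.x k) :=
    mul_nonneg (mul_nonneg hγ.le (by linarith [hc.δ_nonneg])) hD0
  simp only [xyEnergy]
  simp only [Trace.iter] at *
  linear_combination hyoung' + h1 + h2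

theorem xyEnergy_zero (h : IsRun P φp φd μ c .xy x₀ y₀ r) (x : Euc n) (y : Dual p m) :
    xyEnergy P φp φd (r.iter c .xy 0) x y = c.γ₀ * bregman φp x x₀ + bregman φd y y₀ := by
  simp [xyEnergy, Trace.iter, shift, h.x_zero, h.y_zero, h.γ_zero]

theorem sum_gap_xy (h : IsRun P φp φd μ c .xy x₀ y₀ r) (hf : P.FunctionsOK μ)
    (hs : P.SetsOK) (hφp : IsDistGen φp P.X) (hφd : IsDistGen φd P.Y)
    (hφp_euclid : 0 < μ → ∀ x, φp x = 1 / 2 * ‖x‖ ^ 2) (hc : c.OK .xy)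
    (hx₀ : x₀ ∈ P.X) (hy₀ : y₀ ∈ P.Y) {x : Euc n} {y : Dual p m} (hx : x ∈ P.X)
    (hy : y ∈ P.Y) (K : ℕ) :
    ∑ k ∈ Finset.range K, r.σ k * (P.Φ (r.x (k + 1)) y - P.Φ x (r.y (k + 1)))
      + bregman φd y (r.y K) ≤ c.γ₀ * bregman φp x x₀ + bregman φd y y₀ := by
  have h1 : ∑ k ∈ Finset.range K, r.σ k * (P.Φ (r.x (k + 1)) y - P.Φ x (r.y (k + 1)))
      + xyEnergy P φp φd (r.iter c .xy K) x y ≤ c.γ₀ * bregman φp x x₀ + bregman φd y y₀ := by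
    induction K with
    | zero => simp [h.xyEnergy_zero]
    | succ K ih =>
      rw [Finset.sum_range_succ]
      have hμ := hf.mu_nonneg
      have hstep := xyEnergy_next (I := r.iter c .xy K) hf hs hφp hφd hc.δ_nonneg
        (h.x_mem hx₀ K) (h.y_mem hy₀ K) (h.γ_pos hc hμ K) (h.σPrev_pos hc hμ K).le
        (h.iter_α_pos hc hμ K) (h.iter_β_pos hc hμ K) (h.τ_pos hc hμ K) (h.candidate K)
        (h.accepted K) hx hy
        (h.γ_succ_mul_bregman hμ hφp_euclid K x (r.x (K + 1)))
      change r.σ K * _ + xyEnergy P φp φd (r.iter c .xy (K + 1)) x y ≤ _ at hstep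
      linarith
  linarith [h.xyEnergy_ge (φd := φd) hf hφp hc hx₀ hy₀ K x y]

/-- With the saddle point as reference all gaps are nonnegative, so D_d(ys, y^k) never exceeds the
initial energy. -/
theorem exists_norm_y_le_xy (h : IsRun P φp φd μ c .xy x₀ y₀ r) (hf : P.FunctionsOK μ)
    (hs : P.SetsOK) (hφp : IsDistGen φp P.X) (hφd : IsDistGen φd P.Y)
    (hφp_euclid : 0 < μ → ∀ x, φp x = 1 / 2 * ‖x‖ ^ 2) (hc : c.OK .xy)
    (hx₀ : x₀ ∈ P.X) (hy₀ : y₀ ∈ P.Y) {xs : Euc n} {ys : Dual p m}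
    (hsad : (xs, ys) ∈ P.saddle) : ∃ R : ℝ, ∀ k, ‖r.y k‖ ≤ R := by
  refine ⟨‖ys‖ + √(2 * (c.γ₀ * bregman φp xs x₀ + bregman φd ys y₀)), fun k => ?_⟩
  have hμ := hf.mu_nonneg
  have h1 := h.sum_gap_xy hf hs hφp hφd hφp_euclid hc hx₀ hy₀ hsad.1 hsad.2.1 k
  have h2 : 0 ≤ ∑ j ∈ Finset.range k, r.σ j * (P.Φ (r.x (j + 1)) ys - P.Φ xs (r.y (j + 1))) := by
    refine Finset.sum_nonneg fun j _ => mul_nonneg (h.σ_pos hc hμ j).le (sub_nonneg.2 ?_)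
    exact (hsad.2.2.1 _ (h.y_mem hy₀ (j + 1))).trans (hsad.2.2.2 _ (h.x_mem hx₀ (j + 1)))
  have h3 := hφd.le_bregman (u := ys) (w := r.y k) (h.y_mem hy₀ k)
  have h4 : ‖ys - r.y k‖ ≤ √(2 * (c.γ₀ * bregman φp xs x₀ + bregman φd ys y₀)) :=
    Real.le_sqrt_of_sq_le (by linarith)
  have h5 := norm_sub_le ys (ys - r.y k)
  rw [sub_sub_cancel] at h5
  linarith

end IsRun

end

/-! ### Energy estimate for the yx variant -/

section

variable {n p m : ℕ} {P : Problem n p m} {φp : Euc n → ℝ} {φd : Dual p m → ℝ} {μ B : ℝ}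
  {c : Params} {v : Variant} {x₀ : Euc n} {y₀ : Dual p m} {r : Trace n p m}

/-- The dual part of the energy of the `yx` variant relative to the multiplier `y`. -/
def yxEnergy (P : Problem n p m) (φd : Dual p m → ℝ) (I : Iter n p m) (y : Dual p m) : ℝ :=
  bregman φd y I.y - I.σPrev * ⟪P.res I.x - P.res I.xPrev, y - I.y⟫_ℝ
    + I.σPrev * (1 / (2 * I.α) * ‖P.res I.x - P.res I.xPrev‖ ^ 2)

theorem yxEnergy_nonneg (hφd : IsDistGen φd P.Y) {I : Iter n p m} (hyk : I.y ∈ P.Y)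
    (hσP : 0 ≤ I.σPrev) (hα : 0 < I.α) (hσα : I.σPrev * I.α = c.cα) (hcα : c.cα ≤ 1)
    (y : Dual p m) : 0 ≤ yxEnergy P φd I y := by
  have h := inner_le_young (P.res I.x - P.res I.xPrev) (y - I.y) hα
    (d := bregman φd y I.y) (hφd.le_bregman hyk)
  have h1 := mul_le_mul_of_nonneg_left h hσP
  rw [mul_add, ← mul_assoc I.σPrev I.α, hσα] at h1
  have h2 := mul_le_mul_of_nonneg_right hcα (hφd.bregman_nonneg (u := y) hyk)
  unfold yxEnergy
  linarith

/-- The acceptance test of the `yx` variant multiplied by `σ`, without the `δ` terms. -/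
theorem Accepts.yx_le {I : Iter n p m} {τ : ℝ} {x' : Euc n} {y' : Dual p m}
    (h : Accepts P φp φd c (.yx B) I τ x' y') (hδ : 0 ≤ c.δ) (hγ : 0 < I.γ) (hτ : 0 < τ)
    (hσα : I.σPrev * I.α = c.cα) (hDp : 0 ≤ bregman φp x' I.x) (hDd : 0 ≤ bregman φd y' I.y) :
    I.γ * τ * (P.Φ x' y' - P.Φ I.x y' - ⟪P.gradX I.x y', x' - I.x⟫_ℝ)
      + I.γ * τ * (1 / (2 * nextα c (.yx B) τ (I.γ * τ)) * ‖P.res x' - P.res I.x‖ ^ 2)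
      ≤ I.γ * bregman φp x' I.x + (1 - c.cα) * bregman φd y' I.y := by
  have hσ : 0 < I.γ * τ := mul_pos hγ hτ
  simp only [Accepts, testFun, P.gradY_eq] at h
  have h1 := mul_le_mul_of_nonneg_left h hσ.le
  have e1 : I.γ * τ * (-(c.δ / τ) * bregman φp x' I.x - c.δ / (I.γ * τ) * bregman φd y' I.y)
      = -(I.γ * (c.δ * bregman φp x' I.x)) - c.δ * bregman φd y' I.y := by
    field_simp
  have e2 : I.γ * τ * ((1 / (I.γ * τ) - I.σPrev / (I.γ * τ) * I.α) * bregman φd y' I.y)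
      = (1 - c.cα) * bregman φd y' I.y := by
    rw [← hσα]
    field_simp
  have e3 : I.γ * τ * (1 / τ * bregman φp x' I.x) = I.γ * bregman φp x' I.x := by
    field_simp
  have e4 : 0 ≤ I.γ * (c.δ * bregman φp x' I.x) := by positivity
  have e5 : 0 ≤ c.δ * bregman φd y' I.y := by positivity
  rw [e1, mul_sub, mul_add, mul_sub, e2, e3] at h1
  linarith

/-- The optimality condition of the dual step of the `yx` variant. -/
theorem IsCandidate.yx_dual (hφd : IsDistGen φd P.Y) {I : Iter n p m} (hγ : 0 < I.γ) {τ : ℝ}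
    (hτ : 0 < τ) {x' : Euc n} {y' : Dual p m}
    (hcand : IsCandidate P φp φd (.yx B) I τ x' y') {y : Dual p m}
    (hy : y ∈ Variant.dualDomain (.yx B) P) :
    I.γ * τ * ⟪P.res I.x, y - y'⟫_ℝ + I.σPrev * ⟪P.res I.x - P.res I.xPrev, y - y'⟫_ℝ
      ≤ bregman φd y I.y - bregman φd y y' - bregman φd y' I.y := by
  have hσ : 0 < I.γ * τ := mul_pos hγ hτ
  set θ := I.σPrev / (I.γ * τ) with hθ
  have h := IsArgmin.prox_three_point
    (s := -((1 + θ) • P.gradY I.x I.y - θ • P.gradY I.xPrev I.yPrev)) (w := I.y) hσ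
    (hφd.mono (Variant.dualDomain_subset (.yx B) P)) (Variant.convex_dualDomain (.yx B) P)
    (by simpa only [inner_neg_left] using! hcand.1) hy
  have hσθ : I.γ * τ * θ = I.σPrev := mul_div_cancel₀ _ hσ.ne'
  rw [P.gradY_eq, P.gradY_eq, ← neg_sub y y', inner_neg_neg] at h
  refine le_trans (le_of_eq ?_) h
  rw [← hσθ]
  simp only [inner_sub_left, inner_smul_left, conj_trivial]
  ring

/-- The primal gradient is taken at x^k, so strong convexity yields a multiple of ‖x − x^k‖² rather
than ‖x − x^{k+1}‖². It is dropped, and the weight of the new primal distance stays γ_k. -/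
theorem yxEnergy_next (hf : P.FunctionsOK μ) (hs : P.SetsOK) (hφp : IsDistGen φp P.X)
    (hφd : IsDistGen φd P.Y)
    (hδ : 0 ≤ c.δ) {I : Iter n p m} (hxk : I.x ∈ P.X) (hyk : I.y ∈ P.Y) (hγ : 0 < I.γ)
    (hσP : 0 ≤ I.σPrev) (hα : 0 < I.α) (hσα : I.σPrev * I.α = c.cα) {τ γ' : ℝ} (hτ : 0 < τ)
    {x' : Euc n} {y' : Dual p m} (hcand : IsCandidate P φp φd (.yx B) I τ x' y')
    (hacc : Accepts P φp φd c (.yx B) I τ x' y')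
    {x : Euc n} {y : Dual p m} (hx : x ∈ P.X) (hy : y ∈ Variant.dualDomain (.yx B) P) :
    I.γ * τ * (P.Φ x' y - P.Φ x y') + I.γ * bregman φp x x'
      + yxEnergy P φd (I.next c (.yx B) τ γ' x' y') y
      ≤ I.γ * bregman φp x I.x + yxEnergy P φd I y := by
  have hσ : 0 < I.γ * τ := mul_pos hγ hτ
  have hyk' : y' ∈ P.Y := Variant.dualDomain_subset (.yx B) P hcand.mem.2
  have hacc' := hacc.yx_le hδ hγ hτ hσα (hφp.bregman_nonneg hxk) (hφd.bregman_nonneg hyk)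
  have hx3 := mul_le_mul_of_nonneg_left (hcand.2.prox_three_point hτ hφp hs.convex_X hx) hγ.le
  have hy3 := hcand.yx_dual hφd hγ hτ hy
  have hgrad := mul_le_mul_of_nonneg_left (hf.gradX_inequality hxk hx hyk') hσ.le
  have hlin := P.Φ_sub_right x' y y'
  have hμ : 0 ≤ I.γ * τ * (μ / 2 * ‖x - I.x‖ ^ 2) :=
    mul_nonneg hσ.le (mul_nonneg (by linarith [hf.mu_nonneg]) (sq_nonneg _))
  have hyoung := mul_le_mul_of_nonneg_left (inner_le_young (P.res I.x - P.res I.xPrev) (y' - I.y)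
    hα (hφd.le_bregman hyk)) hσP
  rw [mul_add, ← mul_assoc I.σPrev I.α, hσα] at hyoung
  have e1 : ⟪y - y', P.res x'⟫_ℝ = ⟪P.res I.x, y - y'⟫_ℝ + ⟪P.res x' - P.res I.x, y - y'⟫_ℝ := by
    rw [← inner_add_left, add_sub_cancel, real_inner_comm]
  have e2 : ⟪P.res I.x - P.res I.xPrev, y - y'⟫_ℝ = ⟪P.res I.x - P.res I.xPrev, y - I.y⟫_ℝ
      - ⟪P.res I.x - P.res I.xPrev, y' - I.y⟫_ℝ := by
    rw [← inner_sub_right, sub_sub_sub_cancel_right]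
  have e3 : ⟪P.gradX I.x y', x - I.x⟫_ℝ
      = ⟪P.gradX I.x y', x' - I.x⟫_ℝ - ⟪P.gradX I.x y', x' - x⟫_ℝ := by
    rw [← inner_sub_right, sub_sub_sub_cancel_left]
  rw [e1] at hlin
  rw [e2] at hy3
  rw [e3] at hgrad
  simp only [yxEnergy, Iter.next]
  linear_combination hacc' + hy3 + hgrad + hx3 + hyoung + hμ + (I.γ * τ) * hlin

namespace IsRun

/-- Raising the weight of D_p(x, x^{k+1}) from γ_k to γ_{k+1} at each step is what creates the
quadratic sum on the right. -/
theorem sum_gap_yx (h : IsRun P φp φd μ c (.yx B) x₀ y₀ r) (hf : P.FunctionsOK μ)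
    (hs : P.SetsOK) (hφp : IsDistGen φp P.X) (hφd : IsDistGen φd P.Y)
    (hφp_euclid : 0 < μ → ∀ x, φp x = 1 / 2 * ‖x‖ ^ 2) (hc : c.OK (.yx B))
    (hx₀ : x₀ ∈ P.X) (hy₀ : y₀ ∈ Variant.dualDomain (.yx B) P) {x : Euc n} {y : Dual p m}
    (hx : x ∈ P.X) (hy : y ∈ Variant.dualDomain (.yx B) P) (K : ℕ) :
    ∑ k ∈ Finset.range K, r.σ k * (P.Φ (r.x (k + 1)) y - P.Φ x (r.y (k + 1)))
      ≤ c.γ₀ * bregman φp x x₀ + bregman φd y y₀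
        + ∑ k ∈ Finset.range K, r.σ k * (μ / 2 * ‖x - r.x (k + 1)‖ ^ 2) := by
  have hμ := hf.mu_nonneg
  have hY := Variant.dualDomain_subset (.yx B) P
  have hσα : ∀ k, (r.iter c (.yx B) k).σPrev * (r.iter c (.yx B) k).α = c.cα := fun k =>
    (h.iter_ok hc hμ hx₀ hy₀ k).coeffs
  have hcα : c.cα ≤ 1 := by linarith [hc.coeffs.2.2, hc.δ_nonneg]
  have key : ∑ k ∈ Finset.range K, r.σ k * (P.Φ (r.x (k + 1)) y - P.Φ x (r.y (k + 1)))
      + r.γ K * bregman φp x (r.x K) + yxEnergy P φd (r.iter c (.yx B) K) y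
      ≤ c.γ₀ * bregman φp x x₀ + bregman φd y y₀
        + ∑ k ∈ Finset.range K, r.σ k * (μ / 2 * ‖x - r.x (k + 1)‖ ^ 2) := by
    induction K with
    | zero => simp [yxEnergy, Trace.iter, shift, h.x_zero, h.y_zero, h.γ_zero]
    | succ K ih =>
      rw [Finset.sum_range_succ, Finset.sum_range_succ]
      have hstep := yxEnergy_next (γ' := r.γ (K + 1)) (I := r.iter c (.yx B) K) hf hs hφp hφd
        hc.δ_nonneg (h.x_mem hx₀ K) (hY (h.y_mem hy₀ K)) (h.γ_pos hc hμ K)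
        (h.σPrev_pos hc hμ K).le (h.iter_α_pos hc hμ K) (hσα K)
        (h.τ_pos hc hμ K) (h.candidate K) (h.accepted K) hx hy
      have h4 := h.γ_succ_mul_bregman hμ hφp_euclid K x (r.x (K + 1))
      change r.σ K * _ + r.γ K * bregman φp x (r.x (K + 1))
        + yxEnergy P φd (r.iter c (.yx B) (K + 1)) y
          ≤ r.γ K * bregman φp x (r.x K) + _ at hstep
      linarith
  have h1 := yxEnergy_nonneg hφd (hY (h.y_mem hy₀ K)) (h.σPrev_pos hc hμ K).le
    (h.iter_α_pos hc hμ K) (hσα K) hcα y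
  have h2 : 0 ≤ r.γ K * bregman φp x (r.x K) :=
    mul_nonneg (h.γ_pos hc hμ K).le (hφp.bregman_nonneg (h.x_mem hx₀ K))
  linarith

end IsRun

end

section

/-! ### Gap bounds for the averaged iterates -/

section

variable {E : Type*} [NormedAddCommGroup E] [InnerProductSpace ℝ E] [CompleteSpace E]

theorem IsDistGen.exists_bregman_le_of_isBounded {φ : E → ℝ} {S T : Set E} (h : IsDistGen φ S)
    (hTS : T ⊆ S) (hT : Bornology.IsBounded T) {w : E} (hw : w ∈ S) :
    ∃ C : ℝ, 0 ≤ C ∧ ∀ u ∈ T, bregman φ u w ≤ C := by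
  obtain ⟨L, hL, hl⟩ := h.exists_bregman_le
  obtain ⟨R, hR⟩ := hT.exists_norm_le
  refine ⟨L * (R + ‖w‖) ^ 2, by positivity, fun u hu => (hl u (hTS hu) w hw).trans ?_⟩
  refine mul_le_mul_of_nonneg_left (pow_le_pow_left₀ (norm_nonneg _) ?_ 2) hL.le
  exact (norm_sub_le u w).trans (by linarith [hR u hu])

end

variable {n p m : ℕ} {P : Problem n p m} {φp : Euc n → ℝ} {φd : Dual p m → ℝ} {μ : ℝ}
  {c : Params} {v : Variant} {x₀ : Euc n} {y₀ : Dual p m} {r : Trace n p m}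

/-- As functions of u, ‖x − u‖² and ‖u‖² differ by an affine term. Hence the quadratic errors can be
moved into the gap before Jensen is applied. -/
theorem Problem.FunctionsOK.convexOn_Φ_sub_sq (hf : P.FunctionsOK μ) {y : Dual p m}
    (hy : y ∈ P.Y) (x : Euc n) :
    ConvexOn ℝ P.X fun u => P.Φ u y - μ / 2 * ‖x - u‖ ^ 2 := by
  have h1 := strongConvexOn_iff_convex.1 (hf.strongConvexOn_Φ hy)
  refine ⟨h1.1, fun u hu w hw a b ha hb hab => ?_⟩
  have h2 := h1.2 hu hw ha hb hab
  have hb' : b = 1 - a := by linarith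
  simp only [smul_eq_mul, norm_sub_sq_real, inner_add_right, real_inner_smul_right] at h2 ⊢
  subst hb'
  nlinarith

namespace IsRun

theorem exists_gap_bound_xy (h : IsRun P φp φd μ c .xy x₀ y₀ r) (hf : P.FunctionsOK μ)
    (hs : P.SetsOK) (hφp : IsDistGen φp P.X) (hφd : IsDistGen φd P.Y)
    (hφp_euclid : 0 < μ → ∀ x, φp x = 1 / 2 * ‖x‖ ^ 2) (hc : c.OK .xy)
    (hx₀ : x₀ ∈ P.X) (hy₀ : y₀ ∈ P.Y) {xs : Euc n} {ys : Dual p m}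
    (hsad : (xs, ys) ∈ P.saddle) (R : ℝ) :
    ∃ C : ℝ, 0 ≤ C ∧ ∀ K, 1 ≤ K → ∀ y ∈ P.Y, ‖y‖ ≤ R →
      P.Φ (r.xbar K) y - P.f xs ≤ C / r.T K := by
  have hσ := h.σ_pos hc hf.mu_nonneg
  obtain ⟨C, hC, hCle⟩ := hφd.exists_bregman_le_of_isBounded (T := P.Y ∩ Metric.closedBall 0 R)
    inter_subset_left (Metric.isBounded_closedBall.subset inter_subset_right) hy₀
  have hD := mul_nonneg hc.γ₀_pos.le (hφp.bregman_nonneg hx₀ (u := xs))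
  refine ⟨(c.γ₀ * bregman φp xs x₀ + C) / r.σ 0, div_nonneg (by linarith) (hσ 0).le,
    fun K hK y hy hyR => ?_⟩
  have hyK : r.y K ∈ P.Y := h.y_mem hy₀ K
  have h1 := h.sum_gap_xy hf hs hφp hφd hφp_euclid hc hx₀ hy₀ hsad.1 hy K
  have h2 := hCle y ⟨hy, by simpa using hyR⟩
  have h3 := hφd.bregman_nonneg hyK (u := y)
  have h4 := Trace.gap_average_le (((hf.strongConvexOn_Φ hy).mono hf.mu_nonneg).convexOn
    fun s => by simp) (h.x_mem hx₀) hσ hK (x := xs)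
    (C := c.γ₀ * bregman φp xs x₀ + C) (by linarith)
  have h5 := Problem.inner_res_nonpos_of_mem_saddle hsad
    (Trace.ybar_mem P.convex_Y (h.y_mem hy₀) hσ hK)
  rw [P.Φ_eq xs] at h4
  linarith

/-- The primal reference point is the midpoint of `x̄^K` and `x⋆`, so that strong convexity of
`Φ(·, ȳ^K)` absorbs the quadratic error terms of the energy estimate. -/
theorem exists_gap_bound_yx {B : ℝ} (h : IsRun P φp φd μ c (.yx B) x₀ y₀ r)
    (hf : P.FunctionsOK μ) (hs : P.SetsOK) (hφp : IsDistGen φp P.X) (hφd : IsDistGen φd P.Y)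
    (hφp_euclid : 0 < μ → ∀ x, φp x = 1 / 2 * ‖x‖ ^ 2) (hc : c.OK (.yx B))
    (hx₀ : x₀ ∈ P.X) (hy₀ : y₀ ∈ Variant.dualDomain (.yx B) P) {xs : Euc n} {ys : Dual p m}
    (hsad : (xs, ys) ∈ P.saddle) :
    ∃ C : ℝ, 0 ≤ C ∧ ∀ K, 1 ≤ K → ∀ y ∈ P.Y, ‖y‖ ≤ B →
      P.Φ (r.xbar K) y - P.f xs ≤ C / r.T K := by
  have hσ := h.σ_pos hc hf.mu_nonneg
  have hsub := Variant.dualDomain_subset (.yx B) P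
  -- The reference points will depend on K, so the initial distances are bounded uniformly over
  -- `P.X` and the dual ball.
  obtain ⟨C₁, hC₁, hle₁⟩ := hφp.exists_bregman_le_of_isBounded subset_rfl hs.compact_X.isBounded hx₀
  obtain ⟨C₂, hC₂, hle₂⟩ := hφd.exists_bregman_le_of_isBounded
    (T := Variant.dualDomain (.yx B) P) hsub
    (isBounded_iff_forall_norm_le.2 ⟨B, fun y hy => hy.2⟩) (hsub hy₀)
  have hγ₀ := hc.γ₀_pos
  have hC : 0 ≤ c.γ₀ * C₁ + C₂ := by positivity
  refine ⟨2 * ((c.γ₀ * C₁ + C₂) / r.σ 0), mul_nonneg zero_le_two (div_nonneg hC (hσ 0).le),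
    fun K hK y' hy' hyB => ?_⟩
  have hxbar := Trace.xbar_mem hs.convex_X (h.x_mem hx₀) hσ hK
  have hybar := Trace.ybar_mem (Variant.convex_dualDomain (.yx B) P) (h.y_mem hy₀) hσ hK
  have hhalf : (1 / 2 : ℝ) + 1 / 2 = 1 := by norm_num
  have hx : (1 / 2 : ℝ) • r.xbar K + (1 / 2 : ℝ) • xs ∈ P.X :=
    hs.convex_X hxbar hsad.1 (by norm_num) (by norm_num) hhalf
  -- The dual midpoint makes ½Φ(x̄, ȳ) appear, which cancels the same term from strong convexity at
  -- the primal midpoint; half of the wanted gap remains, hence the factor 2 in the constant.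
  have hy : (1 / 2 : ℝ) • r.ybar K + (1 / 2 : ℝ) • y' ∈ Variant.dualDomain (.yx B) P :=
    Variant.convex_dualDomain (.yx B) P hybar ⟨hy', hyB⟩ (by norm_num) (by norm_num) hhalf
  have h1 := h.sum_gap_yx hf hs hφp hφd hφp_euclid hc hx₀ hy₀ hx hy K
  have h2 := Trace.gap_average_le (hf.convexOn_Φ_sub_sq (hsub hy)
      ((1 / 2 : ℝ) • r.xbar K + (1 / 2 : ℝ) • xs)) (h.x_mem hx₀) hσ hK
    (x := (1 / 2 : ℝ) • r.xbar K + (1 / 2 : ℝ) • xs) (C := c.γ₀ * C₁ + C₂) (by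
      have h3 := mul_le_mul_of_nonneg_left (hle₁ _ hx) hγ₀.le
      have h4 := hle₂ _ hy
      simp only [sub_right_comm _ (μ / 2 * _), mul_sub _ _ (μ / 2 * _), Finset.sum_sub_distrib]
      linarith)
  -- The gain (μ/8)‖x̄ − xs‖² equals the error (μ/2)‖midpoint − x̄‖² exactly.
  have h3 := (hf.strongConvexOn_Φ (hsub hybar)).2 hxbar hsad.1 (by norm_num) (by norm_num) hhalf
  have h4 : ‖(1 / 2 : ℝ) • r.xbar K + (1 / 2 : ℝ) • xs - r.xbar K‖ ^ 2
      = 1 / 4 * ‖r.xbar K - xs‖ ^ 2 := by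
    have : (1 / 2 : ℝ) • r.xbar K + (1 / 2 : ℝ) • xs - r.xbar K
        = (-(1 / 2) : ℝ) • (r.xbar K - xs) := by module
    rw [this, norm_smul, mul_pow]
    norm_num
  have h5 := Problem.inner_res_nonpos_of_mem_saddle hsad (hsub hybar)
  rw [h4] at h2
  simp only [smul_eq_mul, P.Φ_eq xs, P.Φ_eq (r.xbar K), inner_add_left, real_inner_smul_left] at h2 h3 ⊢
  rw [mul_div_assoc]
  linarith

end IsRun

/-- A saddle point and a bound on the Lagrangian gap over a ball of multipliers that is larger than
the norm of its dual component. -/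
theorem IsRun.exists_gap_bound (h : IsRun P φp φd μ c v x₀ y₀ r) (hf : P.FunctionsOK μ)
    (hs : P.SetsOK) (hsad : P.saddle.Nonempty) (hφp : IsDistGen φp P.X) (hφd : IsDistGen φd P.Y)
    (hφp_euclid : 0 < μ → ∀ x, φp x = 1 / 2 * ‖x‖ ^ 2) (hv : v.DualBound P) (hc : c.OK v)
    (hx₀ : x₀ ∈ P.X) (hy₀ : y₀ ∈ v.dualDomain P) :
    ∃ (xs : Euc n) (ys : Dual p m) (R C : ℝ), (xs, ys) ∈ P.saddle ∧ ‖ys‖ < R ∧ 0 ≤ C ∧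
      ∀ K, 1 ≤ K → ∀ y ∈ P.Y, ‖y‖ ≤ R → P.Φ (r.xbar K) y - P.f xs ≤ C / r.T K := by
  obtain ⟨⟨xs, ys⟩, hsad⟩ := hsad
  cases v with
  | xy =>
    obtain ⟨C, hC, hle⟩ := h.exists_gap_bound_xy hf hs hφp hφd hφp_euclid hc hx₀ hy₀ hsad (‖ys‖ + 1)
    exact ⟨xs, ys, _, C, hsad, lt_add_one _, hC, hle⟩
  | yx B =>
    obtain ⟨Bbar, -, ⟨y, hy, hyB⟩, hB⟩ := hv
    obtain ⟨C, hC, hle⟩ := h.exists_gap_bound_yx hf hs hφp hφd hφp_euclid hc hx₀ hy₀ hsad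
    exact ⟨xs, y, B, C, hf.mem_saddle_of_mem_dualOpt hs hsad hy, hyB.trans_lt hB, hC, hle⟩

theorem IsRun.exists_norm_y_le (h : IsRun P φp φd μ c v x₀ y₀ r) (hf : P.FunctionsOK μ)
    (hs : P.SetsOK) (hsad : P.saddle.Nonempty) (hφp : IsDistGen φp P.X) (hφd : IsDistGen φd P.Y)
    (hφp_euclid : 0 < μ → ∀ x, φp x = 1 / 2 * ‖x‖ ^ 2) (hc : c.OK v)
    (hx₀ : x₀ ∈ P.X) (hy₀ : y₀ ∈ v.dualDomain P) : ∃ R : ℝ, ∀ k, ‖r.y k‖ ≤ R := by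
  obtain ⟨⟨xs, ys⟩, hsad⟩ := hsad
  cases v with
  | xy => exact h.exists_norm_y_le_xy hf hs hφp hφd hφp_euclid hc hx₀ hy₀ hsad
  | yx B => exact ⟨B, fun k => (h.y_mem hy₀ k).2⟩

end

end APDB

end

/-! ### Assembly of the rates -/

theorem mainTheorem9 {n p m : ℕ} (P : APDB.Problem n p m) (μ : ℝ)
    (hsets : P.SetsOK) (hfun : P.FunctionsOK μ) (hsaddle : P.saddle.Nonempty)
    (φp : APDB.Euc n → ℝ) (φd : APDB.Dual p m → ℝ)
    (hφp : APDB.IsDistGen φp P.X) (hφd : APDB.IsDistGen φd P.Y)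
    (hφp_euclid : 0 < μ → ∀ x, φp x = 1 / 2 * ‖x‖ ^ 2)
    (v : APDB.Variant) (hbound : v.DualBound P)
    (c : APDB.Params) (hc : c.OK v)
    (x₀ : APDB.Euc n) (hx₀ : x₀ ∈ P.X) (y₀ : APDB.Dual p m) (hy₀ : y₀ ∈ v.dualDomain P) :
    (∃ r : APDB.Trace n p m, APDB.IsRun P φp φd μ c v x₀ y₀ r) ∧
    ∀ r : APDB.Trace n p m, APDB.IsRun P φp φd μ c v x₀ y₀ r →
      (∃ C : ℝ, 0 < C ∧ ∀ K : ℕ, 1 ≤ K →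
        max (P.infeas (r.xbar K)) |P.f (r.xbar K) - P.fStar| ≤ C / r.T K) ∧
      (μ = 0 → ∃ a : ℝ, 0 < a ∧ ∀ K : ℕ, 1 ≤ K → a * (K : ℝ) ≤ r.T K) ∧
      (0 < μ → ∃ a : ℝ, 0 < a ∧ ∀ K : ℕ, 1 ≤ K → a * (K : ℝ) ^ 2 ≤ r.T K) ∧
      (0 < μ → ∃ C : ℝ, 0 < C ∧ ∀ xs ∈ P.primalOpt, ∀ K : ℕ, 1 ≤ K →
        ‖r.xbar K - xs‖ ^ 2 ≤ C / (K : ℝ) ^ 2) := by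
  refine ⟨APDB.exists_isRun hfun hsets hφp hφd hc hx₀ hy₀, fun r hr => ?_⟩
  have hμ := hfun.mu_nonneg
  have hτ := hr.τ_pos hc hμ
  have hγ := hr.γ_pos hc hμ
  have hσ := hr.σ_pos hc hμ
  obtain ⟨xs, ys, R, C, hsad, hR, hC, hgap⟩ :=
    hr.exists_gap_bound hfun hsets hsaddle hφp hφd hφp_euclid hbound hc hx₀ hy₀
  obtain ⟨Ry, hRy⟩ := hr.exists_norm_y_le hfun hsets hsaddle hφp hφd hφp_euclid hc hx₀ hy₀
  obtain ⟨s, hs, hstep⟩ :=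
    hr.exists_step_lower_bound hfun hsets hφp hφd hc hx₀ hy₀ hRy
  obtain ⟨h1, h2⟩ := APDB.Trace.rates_of_gap hfun hsets (hr.x_mem hx₀) hσ hsad hC hR hgap
  have hquad := fun h : 0 < μ =>
    APDB.Trace.quadratic_growth h hr.γ_succ (hγ 0) hγ hτ hs hstep
  refine ⟨h1, fun h => ?_, hquad, fun h => ?_⟩
  · refine APDB.Trace.linear_growth (fun k => ?_) (hγ 0) hτ hs hstep
    induction k with
    | zero => rfl
    | succ k ih => rw [hr.γ_succ, h, zero_mul, add_zero, mul_one, ih]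
  · obtain ⟨a, ha, hT⟩ := hquad h
    obtain ⟨C', hC', hle⟩ := h2 h
    refine ⟨C' / a, div_pos hC' ha, fun x hx K hK => ?_⟩
    -- For μ > 0 the optimal solution is unique, so the bound for the saddle point covers every
    -- optimum with one constant.
    rw [hfun.eq_of_mem_primalOpt hsets h hsad hx, div_div]
    have hK0 : (0 : ℝ) < K := by exact_mod_cast hK
    exact (hle K hK).trans (div_le_div_of_nonneg_left hC'.le (by positivity) (hT K hK))
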